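/- A Seidel matrix of order $n$ is a symmetric real $n\times n$ matrix with zero diagonal all of whose off-diagonal entries are $\pm1$. The graph of a Seidel matrix has the row indices as vertices, two distinct vertices $i,j$ being adjacent if and only if the entry in position $(i,j)$ is $-1$. For a Seidel matrix $S$, the switching graph $\mathcal{S}w(S)$ is the graph, on $2n$ vertices, of the Seidel matrix $$\begin{pmatrix} S & -S+\mathbf I\\ -S+\mathbf I & S\end{pmatrix},$$ and $\alpha([S])$ and $\omega([S])$ denote the independence number and the clique number of $\mathcal{S}w(S)$; they depend only on the switching class $[S]$ of $S$. Theorem. Let $S$ be a Seidel matrix of order $n\ge 277$ with smallest eigenvalue $\lambda_{\min}(S)=-5$ and with $\omega([S])=4$. If $\alpha([S])\ge 29$, then $$\operatorname{rk}(S+5\mathbf I)\ \ge\ \frac{2n}{3}+1 .$$ -/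

import Mathlib

/-- A Seidel matrix: a symmetric matrix with `0` on the diagonal and `1` or `-1` everywhere else. -/
structure IsSeidel {V : Type*} (S : Matrix V V ℝ) : Prop where
  isSymm : S.IsSymm
  diag_eq_zero : ∀ i, S i i = 0
  off_diag : ∀ i j, i ≠ j → S i j = 1 ∨ S i j = -1

/-- The graph corresponding to a Seidel matrix `S`: distinct vertices `i`, `j` are adjacent if and
only if `S i j = -1` (the symmetrization in `SimpleGraph.fromRel` is void, as `S` is symmetric). -/
def seidelGraph {V : Type*} (S : Matrix V V ℝ) : SimpleGraph V :=
  SimpleGraph.fromRel fun i j => S i j = -1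

/-- The switching graph `Sw(S)` of a Seidel matrix `S`: the graph of the Seidel matrix with blocks
`S`, `I - S`, `I - S`, `S`. -/
def switchingGraph {V : Type*} [DecidableEq V] (S : Matrix V V ℝ) : SimpleGraph (V ⊕ V) :=
  seidelGraph (Matrix.fromBlocks S (1 - S) (1 - S) S)

/-- The independence number `α([S])` of the switching class of `S`. -/
noncomputable def switchingIndepNum {V : Type*} [DecidableEq V] (S : Matrix V V ℝ) : ℕ :=
  (switchingGraph S).indepNum

/-- The clique number `ω([S])` of the switching class of `S`. -/
noncomputable def switchingCliqueNum {V : Type*} [DecidableEq V] (S : Matrix V V ℝ) : ℕ :=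
  (switchingGraph S).cliqueNum

set_option linter.unusedSectionVars false

open Matrix Finset

/-! ### The forms of `2I - A` and `4I - 2A + J`. -/

section QuadraticForm

variable {V : Type*} [Fintype V] [DecidableEq V] (G : SimpleGraph V) [DecidableRel G.Adj]

/-! After switching, `S + 5I` becomes `4I - 2A + J` for a graph `G`, with form `2Q(x) + (∑ x)²`,
where `Q` is the form of `2I - A`. Positive semidefiniteness makes `Q` nonnegative on sum-zero
vectors, and by rank-nullity the claim is that the nullity `d` satisfies `3(d + 1) ≤ n`. The
independent 29-set of the switching graph becomes a coclique of `G`, and switching outside vertices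
leaves each with at most 14 neighbours in it.

Degrees are then bounded. Minimising the form over the coordinates in the coclique
(`coclique_elimination`) and testing the result on stars gives degree at most 37 everywhere. A star
with five leaves has `Q ≤ -2`; with degrees bounded, enough vertices lie outside its closed
neighbourhood to cancel its sum cheaply, which contradicts positivity (`not_star_of_card`). So all
degrees are at most 4.

For the nullity there are two good cases. If `Q ≥ 0` everywhere, each component contributes at most
one null direction of `2I - A`, and only if it has at least three vertices
(`finrank_seidelKer_of_nonneg`). If `Q < 0` on a vector of small support, the closed neighbourhood
of the support bounds the nullity (`finrank_seidelKer_le_of_neg`). A vertex of degree 4, or two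
vertices of degree 3 at distance at most 2, leads to one of these cases. Otherwise the closed
neighbourhoods of degree-3 vertices are disjoint, so there are at most `n/4` such vertices, and the
values there together with the sum determine a null vector unless `Q ≥ 0`
(`finrank_seidelKer_of_separated`). -/

/-- The operator `2I - A`, where `A` is the adjacency matrix of `G`. -/
def adjOp (x : V → ℝ) : V → ℝ := fun v => 2 * x v - ∑ u ∈ G.neighborFinset v, x u

/-- The bilinear form of `2I - A`. -/
def adjBilin (x y : V → ℝ) : ℝ := ∑ v, x v * adjOp G y v

/-- The quadratic form of `2I - A`. -/
def adjQuad (x : V → ℝ) : ℝ := adjBilin G x x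

/-- The matrix `4I - 2A + J` of a graph with adjacency matrix `A`. -/
def seidelGram : Matrix V V ℝ := (4 : ℝ) • 1 - (2 : ℝ) • G.adjMatrix ℝ + Matrix.of fun _ _ => 1

lemma sum_neighbor_symm (x y : V → ℝ) :
    ∑ v, x v * ∑ u ∈ G.neighborFinset v, y u = ∑ v, y v * ∑ u ∈ G.neighborFinset v, x u := by
  simp only [SimpleGraph.neighborFinset_eq_filter, Finset.sum_filter, Finset.mul_sum]
  rw [Finset.sum_comm]
  refine Finset.sum_congr rfl fun v _ => Finset.sum_congr rfl fun u _ => ?_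
  simp only [G.adj_comm v u]
  split_ifs <;> ring

lemma adjBilin_comm (x y : V → ℝ) : adjBilin G x y = adjBilin G y x := by
  have := sum_neighbor_symm G x y
  simp only [adjBilin, adjOp, mul_sub, Finset.sum_sub_distrib, this]
  congr 1
  exact Finset.sum_congr rfl fun v _ => by ring

lemma adjOp_add_smul (x y : V → ℝ) (c : ℝ) :
    adjOp G (fun v => x v + c * y v) = fun v => adjOp G x v + c * adjOp G y v := by
  funext v
  simp only [adjOp, Finset.sum_add_distrib, ← Finset.mul_sum]
  ring

lemma adjQuad_add_smul (x y : V → ℝ) (c : ℝ) :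
    adjQuad G (fun v => x v + c * y v) =
      adjQuad G x + 2 * c * adjBilin G y x + c ^ 2 * adjQuad G y := by
  have h := adjBilin_comm G x y
  have e : adjQuad G (fun v => x v + c * y v) = adjBilin G x x + c * adjBilin G x y
      + c * adjBilin G y x + c ^ 2 * adjBilin G y y := by
    simp only [adjQuad, adjBilin, adjOp_add_smul, Finset.mul_sum, ← Finset.sum_add_distrib]
    exact Finset.sum_congr rfl fun v _ => by ring
  rw [e, h, adjQuad, adjQuad]; ring

lemma adjQuad_eq (x : V → ℝ) :
    adjQuad G x = 2 * ∑ v, x v ^ 2 - ∑ v, ∑ u ∈ G.neighborFinset v, x v * x u := by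
  simp only [adjQuad, adjBilin, adjOp, mul_sub, Finset.sum_sub_distrib, Finset.mul_sum]
  congr 1
  exact Finset.sum_congr rfl fun v _ => by ring

lemma adjQuad_smul (c : ℝ) (y : V → ℝ) : adjQuad G (fun v => c * y v) = c ^ 2 * adjQuad G y := by
  simp only [adjQuad_eq, mul_sub, Finset.mul_sum]
  congr 1
  · exact Finset.sum_congr rfl fun v _ => by ring
  · exact Finset.sum_congr rfl fun v _ => Finset.sum_congr rfl fun u _ => by ring

/-- Off-diagonal coefficients of `2I - A` are nonpositive, so removing signs can only lower the
form. -/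
lemma adjQuad_abs_le (x : V → ℝ) : adjQuad G (fun v => |x v|) ≤ adjQuad G x := by
  simp only [adjQuad_eq, sq_abs]
  refine sub_le_sub_left (Finset.sum_le_sum fun v _ => Finset.sum_le_sum fun u _ => ?_) _
  rw [← abs_mul]; exact le_abs_self _

lemma adjBilin_single (z : V) (x : V → ℝ) :
    adjBilin G (Pi.single z 1) x = adjOp G x z := by
  simp [adjBilin, Pi.single_apply]

lemma adjQuad_single (z : V) : adjQuad G (Pi.single z 1) = 2 := by
  rw [adjQuad, adjBilin_single]
  simp [adjOp, Pi.single_apply]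

/-- Exact minimisation along one coordinate: wherever `(2I - A)h` is nonzero, changing a single
entry strictly lowers the form. -/
lemma adjQuad_perturb (h : V → ℝ) (z : V) :
    adjQuad G (fun v => h v + (-(adjOp G h z) / 2) * (Pi.single z 1 : V → ℝ) v) =
      adjQuad G h - (adjOp G h z) ^ 2 / 2 := by
  rw [adjQuad_add_smul, adjBilin_single, adjQuad_single]; ring

lemma adjOp_eq_zero_of_posSemidef (hQ : ∀ f, 0 ≤ adjQuad G f) {z : V → ℝ} (hz : adjQuad G z ≤ 0) :
    adjOp G z = 0 := by
  funext v
  have h1 := hQ (fun u => z u + (-(adjOp G z v) / 2) * (Pi.single v 1 : V → ℝ) u)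
  rw [adjQuad_perturb] at h1
  have : (adjOp G z v) ^ 2 ≤ 0 := by linarith
  simpa using pow_eq_zero_iff (two_ne_zero) |>.1 (le_antisymm this (sq_nonneg _))

lemma sum_abs_pos {x : V → ℝ} (hx : x ≠ 0) : 0 < ∑ v, |x v| := by
  obtain ⟨v, hv⟩ := Function.ne_iff.1 hx
  exact Finset.sum_pos' (fun _ _ => abs_nonneg _) ⟨v, Finset.mem_univ _, abs_pos.2 hv⟩

lemma seidelGram_mulVec (x : V → ℝ) (v : V) :
    (seidelGram G *ᵥ x) v = 2 * adjOp G x v + ∑ u, x u := by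
  simp only [seidelGram, Matrix.add_mulVec, Matrix.sub_mulVec, Matrix.smul_mulVec,
    Matrix.one_mulVec, Pi.add_apply, Pi.sub_apply, Pi.smul_apply, smul_eq_mul,
    SimpleGraph.adjMatrix_mulVec_apply, adjOp]
  simp [Matrix.mulVec, dotProduct]
  ring

lemma seidelGram_quad (x : V → ℝ) :
    x ⬝ᵥ (seidelGram G *ᵥ x) = 2 * adjQuad G x + (∑ v, x v) ^ 2 := by
  simp only [dotProduct, seidelGram_mulVec, adjQuad, adjBilin, mul_add, Finset.sum_add_distrib]
  rw [← Finset.sum_mul, sq]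
  congr 1
  rw [Finset.mul_sum]
  exact Finset.sum_congr rfl fun v _ => by ring

/-- The null space of `4I - 2A + J`. -/
def seidelKer : Submodule ℝ (V → ℝ) := LinearMap.ker (seidelGram G).mulVecLin

lemma mem_seidelKer {x : V → ℝ} :
    x ∈ seidelKer G ↔ ∀ v, 2 * adjOp G x v + ∑ u, x u = 0 := by
  rw [seidelKer, LinearMap.mem_ker, Matrix.mulVecLin_apply, funext_iff]
  simp only [seidelGram_mulVec, Pi.zero_apply]

lemma quad_eq_zero_of_mem_seidelKer {x : V → ℝ} (hx : x ∈ seidelKer G) :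
    2 * adjQuad G x + (∑ v, x v) ^ 2 = 0 := by
  rw [← seidelGram_quad]
  have : seidelGram G *ᵥ x = 0 := hx
  rw [this, dotProduct_zero]

lemma finrank_le_card_of_injOn {ι : Type*} [Fintype ι] (K : Submodule ℝ (V → ℝ))
    (f : (V → ℝ) →ₗ[ℝ] (ι → ℝ)) (hf : ∀ x ∈ K, f x = 0 → x = 0) :
    Module.finrank ℝ K ≤ Fintype.card ι := by
  rw [← Module.finrank_fintype_fun_eq_card ℝ (η := ι)]
  refine LinearMap.finrank_le_finrank_of_injective (f := f.comp K.subtype) ?_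
  rw [injective_iff_map_eq_zero]
  intro x hx
  exact Subtype.ext (hf x x.2 hx)

lemma finrank_le_card_of_vanishing (K : Submodule ℝ (V → ℝ)) (Z : Finset V)
    (hZ : ∀ x ∈ K, (∀ v ∈ Z, x v = 0) → x = 0) : Module.finrank ℝ K ≤ Z.card := by
  have := finrank_le_card_of_injOn (ι := Z) K (LinearMap.funLeft ℝ ℝ Subtype.val)
    (fun x hx h => hZ x hx fun v hv => congrFun h ⟨v, hv⟩)
  simpa using this

variable {G}

/-- A null vector of `2I - A` with nonzero sum forces `2I - A` to be positive semidefinite. -/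
lemma adjQuad_nonneg_of_null (hM : ∀ x : V → ℝ, 0 ≤ 2 * adjQuad G x + (∑ v, x v) ^ 2)
    {g : V → ℝ} (hg : adjOp G g = 0) (hs : ∑ v, g v ≠ 0) (f : V → ℝ) : 0 ≤ adjQuad G f := by
  -- Subtracting this multiple of `g` makes the sum zero and leaves the form unchanged.
  have h := hM (fun v => f v + (-(∑ v, f v) / ∑ v, g v) * g v)
  have h0 : adjBilin G f g = 0 := by simp [adjBilin, hg]
  have h1 : adjQuad G g = 0 := by simp [adjQuad, adjBilin, hg]
  rw [adjQuad_add_smul, adjBilin_comm, h0, h1, Finset.sum_add_distrib, ← Finset.mul_sum,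
    div_mul_cancel₀ _ hs] at h
  linarith [h]

/-- If `2I - A` is negative at a nonnegative vector, the nullity of `4I - 2A + J` is at most the
size of the closed neighbourhood of the support. -/
lemma finrank_seidelKer_le_of_neg (hM : ∀ x : V → ℝ, 0 ≤ 2 * adjQuad G x + (∑ v, x v) ^ 2)
    {h : V → ℝ} (h0 : ∀ v, 0 ≤ h v) (hneg : adjQuad G h < 0) (Z : Finset V)
    (hZ : ∀ v, h v ≠ 0 → v ∈ Z ∧ ∀ u, G.Adj v u → u ∈ Z) :
    Module.finrank ℝ (seidelKer G) ≤ Z.card := by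
  refine finrank_le_card_of_vanishing _ Z fun x hx hxZ => ?_
  by_contra hne
  have hp := sum_abs_pos hne
  set p := ∑ v, |x v|
  set q := ∑ v, h v
  have hq : 0 < q := by
    have : h ≠ 0 := by
      rintro rfl
      simp [adjQuad, adjBilin] at hneg
    simpa [abs_of_nonneg (h0 _)] using sum_abs_pos this
  have hx1 : adjQuad G (fun v => |x v|) ≤ 0 := by
    have := quad_eq_zero_of_mem_seidelKer G hx
    have := adjQuad_abs_le G x
    nlinarith [sq_nonneg (∑ v, x v)]
  have hcross : adjBilin G h (fun v => |x v|) = 0 := by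
    refine Finset.sum_eq_zero fun v _ => ?_
    by_cases hv : h v = 0
    · simp [hv]
    · have h1 := hZ v hv
      have : adjOp G (fun v => |x v|) v = 0 := by
        simp only [adjOp, hxZ v h1.1, abs_zero, mul_zero, zero_sub, neg_eq_zero]
        refine Finset.sum_eq_zero fun u hu => ?_
        rw [hxZ u (h1.2 u (by simpa using hu)), abs_zero]
      rw [this, mul_zero]
  -- The coefficients make the sum zero. Since `x` vanishes around the support of `h`, there is no
  -- cross term, and the form is at most `p²` times its negative value at `h`.
  have key := hM (fun v => (p * h v) + (-q) * |x v|)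
  rw [adjQuad_add_smul, adjBilin_comm] at key
  have e1 : adjBilin G (fun v => p * h v) (fun v => |x v|) = 0 := by
    rw [← mul_zero p, ← hcross, adjBilin, adjBilin, Finset.mul_sum]
    exact Finset.sum_congr rfl fun v _ => by ring
  have e3 : ∑ v, (p * h v + (-q) * |x v|) = 0 := by
    rw [Finset.sum_add_distrib, ← Finset.mul_sum, ← Finset.mul_sum]
    change p * q + (-q) * p = 0
    ring
  rw [e1, e3, adjQuad_smul] at key
  nlinarith [mul_pos hp hp, mul_pos hq hq, mul_neg_of_pos_of_neg (mul_pos hp hp) hneg]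

end QuadraticForm

/-! ### Nullity when `2I - A` is semidefinite, or nonpositive on a vector of small support. -/

section BoundedDegree

variable {V : Type*} [Fintype V] [DecidableEq V] {G : SimpleGraph V} [DecidableRel G.Adj]

lemma eq_zero_of_reachable {y : V → ℝ} (h0 : ∀ v, 0 ≤ y v) (hy : adjOp G y = 0) {u v : V}
    (huv : G.Reachable u v) (hu : y u = 0) : y v = 0 := by
  obtain ⟨p⟩ := huv
  induction p with
  | nil => exact hu
  | @cons a b c hab _ ih =>
    refine ih ?_
    have h1 := congrFun hy a
    simp only [adjOp, hu, mul_zero, zero_sub, Pi.zero_apply, neg_eq_zero] at h1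
    exact (Finset.sum_eq_zero_iff_of_nonneg (fun w _ => h0 w)).1 h1 b (by simpa using hab)

/-- Such a component is a single vertex or a single edge, on which `2I - A` is nonsingular. -/
lemma eq_zero_of_small_component [DecidableEq G.ConnectedComponent] {y : V → ℝ} (hy : adjOp G y = 0) (v : V)
    (hc : #{u | G.connectedComponentMk u = G.connectedComponentMk v} ≤ 2) : y v = 0 := by
  have hN : ∀ w, G.connectedComponentMk w = G.connectedComponentMk v →
      #(G.neighborFinset w) ≤ 1 := by
    intro w hw
    have hsub : insert w (G.neighborFinset w) ⊆
        ({u | G.connectedComponentMk u = G.connectedComponentMk v} : Finset V) := by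
      intro u hu
      rcases Finset.mem_insert.1 hu with rfl | hu
      · simpa using hw
      · rw [SimpleGraph.mem_neighborFinset] at hu
        simpa [← hw] using hu.symm.reachable
    have := Finset.card_le_card hsub
    rw [Finset.card_insert_of_notMem (by simp)] at this
    omega
  have hyw : ∀ w, 2 * y w = ∑ u ∈ G.neighborFinset w, y u := fun w => by
    have := congrFun hy w
    simp only [adjOp, Pi.zero_apply] at this
    linarith
  rcases Nat.le_one_iff_eq_zero_or_eq_one.1 (hN v rfl) with h | h
  · have := hyw v
    rw [Finset.card_eq_zero.1 h, Finset.sum_empty] at this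
    linarith
  · obtain ⟨u, hu⟩ := Finset.card_eq_one.1 h
    have huv : G.Adj v u := by
      rw [← SimpleGraph.mem_neighborFinset, hu]; simp
    have hvu : v ∈ G.neighborFinset u := by simpa using huv.symm
    have hu1 : G.neighborFinset u = {v} := by
      refine (Finset.eq_of_subset_of_card_le (by simpa using huv.symm) ?_).symm
      simpa using hN u (by simpa using huv.symm.reachable)
    have h1 := hyw v
    have h2 := hyw u
    rw [hu, Finset.sum_singleton] at h1
    rw [hu1, Finset.sum_singleton] at h2
    linarith

/-- The null space of a positive semidefinite `2I - A` has dimension at most a third of the order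
of the graph. -/
lemma finrank_adjOp_ker_le (hQ : ∀ f, 0 ≤ adjQuad G f) (K : Submodule ℝ (V → ℝ))
    (hK : ∀ x ∈ K, adjOp G x = 0) : 3 * Module.finrank ℝ K ≤ Fintype.card V := by
  classical
  let C : Finset G.ConnectedComponent := {c | 3 ≤ #{u | G.connectedComponentMk u = c}}
  have h1 : Module.finrank ℝ K ≤ Fintype.card C := by
    -- Evaluate at one representative of each component with at least three vertices. The absolute
    -- value of a null vector is again null, and a nonnegative null vector that vanishes at one
    -- vertex vanishes on its component.
    refine finrank_le_card_of_injOn K (LinearMap.funLeft ℝ ℝ fun c : C => c.1.out) ?_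
    intro x hx h
    have hy : adjOp G (fun v => |x v|) = 0 := by
      refine adjOp_eq_zero_of_posSemidef G hQ ((adjQuad_abs_le G x).trans ?_)
      simp [adjQuad, adjBilin, hK x hx]
    funext v
    rw [Pi.zero_apply, ← abs_eq_zero]
    by_cases hv : 3 ≤ #{u | G.connectedComponentMk u = G.connectedComponentMk v}
    · have h2 := congrFun h ⟨G.connectedComponentMk v, by simpa [C] using hv⟩
      refine eq_zero_of_reachable (y := fun v => |x v|) (fun _ => abs_nonneg _) hy
        (u := (G.connectedComponentMk v).out) ?_ ?_
      · exact SimpleGraph.ConnectedComponent.exact (Quot.out_eq _)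
      · simpa using h2
    · exact eq_zero_of_small_component hy v (by omega)
  have h2 : #C * 3 ≤ Fintype.card V := by
    calc #C * 3 ≤ ∑ c ∈ C, #{u | G.connectedComponentMk u = c} :=
          Finset.card_nsmul_le_sum C _ 3 fun c hc => by simpa [C] using hc
      _ ≤ ∑ c, #{u | G.connectedComponentMk u = c} :=
          Finset.sum_le_sum_of_subset (Finset.subset_univ _)
      _ = Fintype.card V := by
          rw [← Finset.card_univ]
          exact (Finset.card_eq_sum_card_fiberwise fun _ _ => Finset.mem_coe.2
            (Finset.mem_univ _)).symm
  rw [Fintype.card_coe] at h1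
  omega

/-- If `2I - A` has a nonzero null vector, pairing with its absolute value `g` forces sum zero on
the null space of `4I - 2A + J`. That space thus lies in the null space of `2I - A`, strictly
because `g` has positive sum; this supplies the `+ 1`. If `2I - A` is nonsingular, a null vector is
determined by its sum. -/
lemma finrank_seidelKer_of_nonneg (hQ : ∀ f, 0 ≤ adjQuad G f) (hn : 6 ≤ Fintype.card V) :
    3 * (Module.finrank ℝ (seidelKer G) + 1) ≤ Fintype.card V := by
  by_cases hK : ∃ z : V → ℝ, z ≠ 0 ∧ adjOp G z = 0
  · obtain ⟨z, hz, hz0⟩ := hK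
    have hy : adjOp G (fun v => |z v|) = 0 := by
      refine adjOp_eq_zero_of_posSemidef G hQ ((adjQuad_abs_le G z).trans ?_)
      simp [adjQuad, adjBilin, hz0]
    have hs := sum_abs_pos hz
    set g : V → ℝ := fun v => |z v|
    let K : Submodule ℝ (V → ℝ) :=
      { carrier := {x | adjOp G x = 0}
        zero_mem' := by funext v; simp [adjOp]
        add_mem' := by
          intro a b (ha : adjOp G a = 0) (hb : adjOp G b = 0)
          have := adjOp_add_smul G a b 1
          rw [ha, hb] at this
          change adjOp G (fun v => a v + b v) = 0
          simpa [funext_iff] using this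
        smul_mem' := by
          intro c a (ha : adjOp G a = 0)
          have := adjOp_add_smul G 0 a c
          rw [ha] at this
          funext v
          simpa [adjOp, Finset.mul_sum] using congrFun this v }
    have hle : seidelKer G ≤ K := by
      intro x hx
      rw [mem_seidelKer] at hx
      have h1 : ∑ v, g v * (2 * adjOp G x v + ∑ u, x u) = 0 :=
        Finset.sum_eq_zero fun v _ => by rw [hx, mul_zero]
      have h2 : adjBilin G g x = 0 := by rw [adjBilin_comm]; simp [adjBilin, hy]
      simp only [mul_add, Finset.sum_add_distrib, ← Finset.sum_mul] at h1
      have h3 : ∑ v, g v * (2 * adjOp G x v) = 2 * adjBilin G g x := by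
        rw [adjBilin, Finset.mul_sum]
        exact Finset.sum_congr rfl fun v _ => by ring
      rw [h3, h2, mul_zero, zero_add] at h1
      have h4 : ∑ u, x u = 0 := (mul_eq_zero.1 h1).resolve_left hs.ne'
      funext v
      have := hx v
      rw [h4] at this
      rw [Pi.zero_apply]
      linarith
    have hlt : seidelKer G < K := by
      refine lt_of_le_of_ne hle fun h => ?_
      have hg : g ∈ seidelKer G := h ▸ hy
      have := quad_eq_zero_of_mem_seidelKer G hg
      have h0 : adjQuad G g = 0 := by simp [adjQuad, adjBilin, hy]
      rw [h0, mul_zero, zero_add] at this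
      exact hs.ne' (pow_eq_zero_iff two_ne_zero |>.1 this)
    have h1 := Submodule.finrank_lt_finrank_of_lt hlt
    have h2 := finrank_adjOp_ker_le hQ K fun x hx => hx
    omega
  · push Not at hK
    have := finrank_le_card_of_injOn (ι := Unit) (seidelKer G)
      (LinearMap.pi fun _ => ∑ v, LinearMap.proj v) (by
        intro x hx h
        by_contra hne
        refine hK x hne ?_
        have hs : ∑ v, x v = 0 := by simpa using congrFun h ()
        funext v
        have := (mem_seidelKer G).1 hx v
        rw [hs] at this
        rw [Pi.zero_apply]
        linarith)
    simp only [Fintype.card_unit] at this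
    omega

lemma card_closedNbhd_le (U : Finset V) {d : ℕ} (hd : ∀ v ∈ U, G.degree v ≤ d) :
    #(U ∪ U.biUnion fun v => G.neighborFinset v) ≤ #U * (d + 1) := by
  calc _ ≤ #U + #(U.biUnion fun v => G.neighborFinset v) := Finset.card_union_le _ _
    _ ≤ #U + #U * d := by
      gcongr
      exact Finset.card_biUnion_le_card_mul _ _ _ fun v hv => by simpa using hd v hv
    _ = _ := by ring

lemma finrank_seidelKer_of_neg_small
    (hM : ∀ x : V → ℝ, 0 ≤ 2 * adjQuad G x + (∑ v, x v) ^ 2)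
    (hn : 277 ≤ Fintype.card V) (hd : ∀ v, G.degree v ≤ 4) {h : V → ℝ} {U : Finset V}
    (hU : ∀ v, h v ≠ 0 → v ∈ U) (hc : #U ≤ 18) (hq : adjQuad G h < 0) :
    3 * (Module.finrank ℝ (seidelKer G) + 1) ≤ Fintype.card V := by
  have h1 := finrank_seidelKer_le_of_neg hM (h := fun v => |h v|) (fun _ => abs_nonneg _)
    ((adjQuad_abs_le G h).trans_lt hq) (U ∪ U.biUnion fun v => G.neighborFinset v) (by
      intro v hv
      have hv' := hU v (by simpa using hv)
      refine ⟨Finset.mem_union_left _ hv', fun u hu => Finset.mem_union_right _ ?_⟩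
      exact Finset.mem_biUnion.2 ⟨v, hv', by simpa using hu⟩)
  -- The nullity is at most `18 * 5 = 90`, and `3 * 91 = 273 ≤ 277`.
  have h2 := card_closedNbhd_le (G := G) U (d := 4) fun v _ => hd v
  omega

/-- Either `h` is a null vector of `2I - A` with nonzero sum, so `2I - A` is semidefinite, or
changing one entry makes the form negative at the cost of one more support vertex. -/
lemma finrank_seidelKer_of_nonpos_small
    (hM : ∀ x : V → ℝ, 0 ≤ 2 * adjQuad G x + (∑ v, x v) ^ 2)
    (hn : 277 ≤ Fintype.card V) (hd : ∀ v, G.degree v ≤ 4) {h : V → ℝ} {U : Finset V}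
    (hs : ∑ v, h v ≠ 0) (hU : ∀ v, h v ≠ 0 → v ∈ U) (hc : #U ≤ 17) (hq : adjQuad G h ≤ 0) :
    3 * (Module.finrank ℝ (seidelKer G) + 1) ≤ Fintype.card V := by
  by_cases h0 : adjOp G h = 0
  · exact finrank_seidelKer_of_nonneg (adjQuad_nonneg_of_null hM h0 hs) (by omega)
  · obtain ⟨z, hz⟩ := Function.ne_iff.1 h0
    refine finrank_seidelKer_of_neg_small hM hn hd
      (h := fun v => h v + (-(adjOp G h z) / 2) * (Pi.single z 1 : V → ℝ) v)
      (U := insert z U) ?_ ((Finset.card_insert_le _ _).trans (by omega)) ?_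
    · intro v hv
      rw [Finset.mem_insert]
      by_contra hcon
      push Not at hcon
      refine hv ?_
      have : h v = 0 := by
        by_contra h'
        exact hcon.2 (hU v h')
      simp [this, hcon.1]
    · rw [adjQuad_perturb]
      have : 0 < (adjOp G h z) ^ 2 := by
        have : adjOp G h z ≠ 0 := hz
        positivity
      linarith

/-- The quadratic form of `2I - A` at `Ae + αe`. -/
lemma adjQuad_nbr_add_smul {e y : V → ℝ} (hy : ∀ v, y v = ∑ u ∈ G.neighborFinset v, e u) (α : ℝ) :
    adjQuad G (fun v => y v + α * e v) =
      2 * ∑ v, y v ^ 2 - ∑ v, y v * ∑ u ∈ G.neighborFinset v, y u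
        + 2 * α * (2 * ∑ v, e v * y v - ∑ v, y v ^ 2)
        + α ^ 2 * (2 * ∑ v, e v ^ 2 - ∑ v, e v * y v) := by
  have h1 : adjBilin G e y = 2 * ∑ v, e v * y v - ∑ v, y v ^ 2 := by
    have := sum_neighbor_symm G e y
    simp only [← hy] at this
    simp only [adjBilin, adjOp, mul_sub, Finset.sum_sub_distrib, this]
    rw [Finset.mul_sum]
    congr 1 <;> exact Finset.sum_congr rfl fun v _ => by ring
  have h2 : adjQuad G e = 2 * ∑ v, e v ^ 2 - ∑ v, e v * y v := by
    rw [adjQuad_eq]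
    simp only [← Finset.mul_sum, ← hy]
  have h3 : adjQuad G y = 2 * ∑ v, y v ^ 2 - ∑ v, y v * ∑ u ∈ G.neighborFinset v, y u := by
    rw [adjQuad_eq]
    simp only [← Finset.mul_sum]
  rw [adjQuad_add_smul, h1, h2, h3]

end BoundedDegree

/-! ### Nullity bound for maximum degree at most 4. -/

section DegreeAtMostFour

variable {V : Type*} [Fintype V] [DecidableEq V] {G : SimpleGraph V} [DecidableRel G.Adj]

/-- The indicator function of the neighbourhood of `v`. -/
def nbrInd (G : SimpleGraph V) [DecidableRel G.Adj] (v w : V) : ℝ := if G.Adj v w then 1 else 0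

lemma nbrInd_nonneg (v w : V) : 0 ≤ nbrInd G v w := by
  unfold nbrInd; split_ifs <;> norm_num

lemma nbrInd_of_adj {v w : V} (h : G.Adj v w) : nbrInd G v w = 1 := if_pos h

lemma nbrInd_comm (v w : V) : nbrInd G v w = nbrInd G w v := by
  simp only [nbrInd, G.adj_comm]

lemma nbrInd_self (v : V) : nbrInd G v v = 0 := by simp [nbrInd]

lemma sum_nbrInd_mul (v : V) (f : V → ℝ) :
    ∑ w, nbrInd G v w * f w = ∑ w ∈ G.neighborFinset v, f w := by
  simp [nbrInd, SimpleGraph.neighborFinset_eq_filter, Finset.sum_filter]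

lemma sum_nbrInd (v : V) : ∑ w, nbrInd G v w = G.degree v := by
  simp [nbrInd, ← SimpleGraph.card_neighborFinset_eq_degree,
    SimpleGraph.neighborFinset_eq_filter]

lemma sum_nbrInd_sq (v : V) : ∑ w, nbrInd G v w ^ 2 = G.degree v := by
  rw [← sum_nbrInd]
  refine Finset.sum_congr rfl fun w _ => ?_
  unfold nbrInd; split_ifs <;> norm_num

lemma nbrInd_eq_sum (v w : V) :
    nbrInd G v w = ∑ u ∈ G.neighborFinset w, (Pi.single v 1 : V → ℝ) u := by
  simp [nbrInd, Pi.single_apply, G.adj_comm]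

lemma sum_nbrInd_mul_sum (u v : V) :
    ∑ w, nbrInd G u w * ∑ x ∈ G.neighborFinset w, nbrInd G v x =
      ∑ w ∈ G.neighborFinset u, ∑ x ∈ G.neighborFinset w, nbrInd G v x :=
  sum_nbrInd_mul u _

lemma adjQuad_star (v : V) :
    adjQuad G (fun w => nbrInd G v w + 2 * (Pi.single v 1 : V → ℝ) w) ≤ 8 - 2 * G.degree v := by
  rw [adjQuad_nbr_add_smul (nbrInd_eq_sum v)]
  have h1 : ∑ w, (Pi.single v 1 : V → ℝ) w * nbrInd G v w = 0 := by
    simp [Pi.single_apply, nbrInd_self]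
  have h2 : ∑ w, (Pi.single v 1 : V → ℝ) w ^ 2 = 1 := by
    simp [Pi.single_apply]
  have h3 : 0 ≤ ∑ w, nbrInd G v w * ∑ x ∈ G.neighborFinset w, nbrInd G v x :=
    Finset.sum_nonneg fun w _ => mul_nonneg (nbrInd_nonneg _ _)
      (Finset.sum_nonneg fun _ _ => nbrInd_nonneg _ _)
  rw [h1, h2, sum_nbrInd_sq]
  linarith

lemma adjQuad_doubleStar {u v : V} (huv : u ≠ v) (α : ℝ) :
    adjQuad G (fun w => (nbrInd G u w + nbrInd G v w)
        + α * ((Pi.single u 1 : V → ℝ) w + (Pi.single v 1 : V → ℝ) w)) ≤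
      (2 - 2 * α) * (G.degree u + G.degree v + 2 * ∑ w ∈ G.neighborFinset u, nbrInd G v w)
        + 4 * α ^ 2 + (4 * α - α ^ 2) * (2 * nbrInd G u v)
        - 2 * ∑ w ∈ G.neighborFinset u, ∑ x ∈ G.neighborFinset w, nbrInd G v x := by
  rw [adjQuad_nbr_add_smul (e := fun w => (Pi.single u 1 : V → ℝ) w + (Pi.single v 1 : V → ℝ) w)
    (y := fun w => nbrInd G u w + nbrInd G v w)
    (fun w => by rw [Finset.sum_add_distrib, nbrInd_eq_sum, nbrInd_eq_sum])]
  have h1 : ∑ w, ((Pi.single u 1 : V → ℝ) w + (Pi.single v 1 : V → ℝ) w) *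
      (nbrInd G u w + nbrInd G v w) = 2 * nbrInd G u v := by
    simp only [add_mul, Finset.sum_add_distrib, Pi.single_apply, ite_mul, one_mul, zero_mul,
      Finset.sum_ite_eq', Finset.mem_univ, if_true, nbrInd_self, nbrInd_comm v u]
    ring
  have h2 : ∑ w, ((Pi.single u 1 : V → ℝ) w + (Pi.single v 1 : V → ℝ) w) ^ 2 = 2 := by
    simp only [add_sq, Finset.sum_add_distrib]
    simp [Pi.single_apply, huv.symm]
    norm_num
  have h3 : ∑ w, (nbrInd G u w + nbrInd G v w) ^ 2 =
      G.degree u + G.degree v + 2 * ∑ w ∈ G.neighborFinset u, nbrInd G v w := by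
    rw [← sum_nbrInd_mul]
    simp only [add_sq, Finset.sum_add_distrib, sum_nbrInd_sq, mul_assoc, ← Finset.mul_sum]
    ring
  have h4 : 2 * ∑ w ∈ G.neighborFinset u, ∑ x ∈ G.neighborFinset w, nbrInd G v x ≤
      ∑ w, (nbrInd G u w + nbrInd G v w) *
        ∑ x ∈ G.neighborFinset w, (nbrInd G u x + nbrInd G v x) := by
    have a1 : ∀ s t : V, 0 ≤ ∑ w, nbrInd G s w * ∑ x ∈ G.neighborFinset w, nbrInd G t x :=
      fun s t => Finset.sum_nonneg fun w _ => mul_nonneg (nbrInd_nonneg _ _)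
        (Finset.sum_nonneg fun _ _ => nbrInd_nonneg _ _)
    have a2 := sum_neighbor_symm G (nbrInd G u) (nbrInd G v)
    simp only [add_mul, mul_add, Finset.sum_add_distrib]
    rw [← sum_nbrInd_mul_sum, ← a2]
    linarith [a1 u u, a1 v v]
  rw [h1, h2, h3]
  linarith

/-- Laplacian decomposition `2I - A = (D - A) + (2I - D)`; each edge is counted in both directions.
-/
lemma sum_sq_sub_eq (z : V → ℝ) :
    2 * adjQuad G z = ∑ v, ∑ u ∈ G.neighborFinset v, (z v - z u) ^ 2
      + 2 * ∑ v, (2 - (G.degree v : ℝ)) * z v ^ 2 := by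
  have h1 := sum_neighbor_symm G (fun _ => 1) (fun v => z v ^ 2)
  simp only [one_mul, Finset.sum_const, SimpleGraph.card_neighborFinset_eq_degree, nsmul_eq_mul,
    mul_one] at h1
  have h2 : ∑ v, ∑ u ∈ G.neighborFinset v, (z v - z u) ^ 2 =
      ∑ v, z v ^ 2 * G.degree v + ∑ v, ∑ u ∈ G.neighborFinset v, z u ^ 2
        - 2 * ∑ v, ∑ u ∈ G.neighborFinset v, z v * z u := by
    simp only [Finset.mul_sum, ← Finset.sum_add_distrib, ← Finset.sum_sub_distrib]
    refine Finset.sum_congr rfl fun v _ => ?_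
    simp only [sub_sq, Finset.sum_add_distrib, Finset.sum_sub_distrib, Finset.sum_const,
      SimpleGraph.card_neighborFinset_eq_degree, nsmul_eq_mul, mul_assoc]
    ring
  have h3 : ∑ v, (2 - (G.degree v : ℝ)) * z v ^ 2 =
      2 * ∑ v, z v ^ 2 - ∑ v, z v ^ 2 * G.degree v := by
    rw [Finset.mul_sum, ← Finset.sum_sub_distrib]
    exact Finset.sum_congr rfl fun v _ => by ring
  rw [h2, h1, h3, adjQuad_eq]
  ring

/-- A null vector of `2I - A` that vanishes at all vertices of degree at least `3` has an absolute
value that is again a null vector. -/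
lemma adjOp_abs_eq_zero {z : V → ℝ} (hz : adjOp G z = 0)
    (hT : ∀ v, 3 ≤ G.degree v → z v = 0) : adjOp G (fun v => |z v|) = 0 := by
  have h1 := sum_sq_sub_eq (G := G) z
  have h0 : adjQuad G z = 0 := by simp [adjQuad, adjBilin, hz]
  have hpos : ∀ v ∈ Finset.univ, 0 ≤ (2 - (G.degree v : ℝ)) * z v ^ 2 := by
    intro v _
    by_cases hv : 3 ≤ G.degree v
    · simp [hT v hv]
    · have : (G.degree v : ℝ) ≤ 2 := by exact_mod_cast (by omega : G.degree v ≤ 2)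
      exact mul_nonneg (by linarith) (sq_nonneg _)
  have hpos' : ∀ v ∈ Finset.univ, 0 ≤ ∑ u ∈ G.neighborFinset v, (z v - z u) ^ 2 :=
    fun v _ => Finset.sum_nonneg fun u _ => sq_nonneg _
  have e1 := Finset.sum_nonneg hpos
  have e2 := Finset.sum_nonneg hpos'
  have f1 := (Finset.sum_eq_zero_iff_of_nonneg hpos).1 (by linarith)
  have f2 := (Finset.sum_eq_zero_iff_of_nonneg hpos').1 (by linarith)
  funext v
  have g2 : ∀ u ∈ G.neighborFinset v, |z u| = |z v| := by
    intro u hu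
    have := (Finset.sum_eq_zero_iff_of_nonneg (fun u _ => sq_nonneg _)).1
      (f2 v (Finset.mem_univ _)) u hu
    have : z v - z u = 0 := by simpa using this
    rw [sub_eq_zero.1 this]
  have g1 := f1 v (Finset.mem_univ _)
  simp only [adjOp, Pi.zero_apply]
  rw [Finset.sum_congr rfl g2, Finset.sum_const, SimpleGraph.card_neighborFinset_eq_degree,
    nsmul_eq_mul, ← sub_mul]
  rcases mul_eq_zero.1 g1 with h | h
  · rw [h, zero_mul]
  · rw [pow_eq_zero_iff two_ne_zero] at h
    simp [h]

/-- Closed neighbourhoods of degree-3 vertices are disjoint 4-sets. Unless `2I - A` is semidefinite,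
a null vector with zero sum that vanishes at these vertices is zero, so the nullity is at most `n/4
+ 1`. -/
lemma finrank_seidelKer_of_separated
    (hM : ∀ x : V → ℝ, 0 ≤ 2 * adjQuad G x + (∑ v, x v) ^ 2) (hn : 24 ≤ Fintype.card V)
    (hd : ∀ v, G.degree v ≤ 3)
    (hadj : ∀ u v, G.degree u = 3 → G.degree v = 3 → ¬ G.Adj u v)
    (hcom : ∀ u v w, G.degree u = 3 → G.degree v = 3 → u ≠ v → G.Adj u w → ¬ G.Adj v w) :
    3 * (Module.finrank ℝ (seidelKer G) + 1) ≤ Fintype.card V := by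
  let T : Finset V := {v | G.degree v = 3}
  have hTc : #T * 4 ≤ Fintype.card V := by
    rw [← Finset.card_univ,
      ← Finset.sum_const_nat (s := T) (f := fun v => #(insert v (G.neighborFinset v))) (m := 4)
      (fun v hv => by
        rw [Finset.card_insert_of_notMem (by simp), SimpleGraph.card_neighborFinset_eq_degree]
        have : G.degree v = 3 := by simpa [T] using hv
        omega), ← Finset.card_biUnion]
    · exact Finset.card_le_card (Finset.subset_univ _)
    · intro u hu v hv huv
      have hu' : G.degree u = 3 := by simpa [T] using hu
      have hv' : G.degree v = 3 := by simpa [T] using hv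
      refine Finset.disjoint_left.2 fun w h1 h2 => ?_
      simp only [Finset.mem_insert, SimpleGraph.mem_neighborFinset] at h1 h2
      rcases h1 with rfl | h1
      · rcases h2 with rfl | h2
        · exact huv rfl
        · exact hadj _ _ hv' hu' h2
      · rcases h2 with rfl | h2
        · exact hadj _ _ hu' hv' h1
        · exact hcom u v w hu' hv' huv h1 h2
  by_cases hz : ∃ z : V → ℝ, z ≠ 0 ∧ adjOp G z = 0 ∧ ∀ v, 3 ≤ G.degree v → z v = 0
  · obtain ⟨z, hz, hz0, hzT⟩ := hz
    exact finrank_seidelKer_of_nonneg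
      (adjQuad_nonneg_of_null hM (adjOp_abs_eq_zero hz0 hzT) (sum_abs_pos hz).ne') (by omega)
  · push Not at hz
    have := finrank_le_card_of_injOn (ι := Option T) (seidelKer G)
      (LinearMap.pi fun o => o.elim (∑ v, LinearMap.proj v) fun v => LinearMap.proj v.1) (by
        intro x hx h
        by_contra hne
        have hs : ∑ v, x v = 0 := by simpa using congrFun h none
        obtain ⟨v, hv, hxv⟩ := hz x hne (by
          funext v
          have := (mem_seidelKer G).1 hx v
          rw [hs] at this
          rw [Pi.zero_apply]
          linarith)
        have hvT : v ∈ T := by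
          have := hd v
          simp only [T, Finset.mem_filter, Finset.mem_univ, true_and]
          omega
        exact hxv (by simpa using congrFun h (some ⟨v, hvT⟩)))
    simp only [Fintype.card_option, Fintype.card_coe] at this
    omega

theorem finrank_seidelKer_of_degree_le_four
    (hM : ∀ x : V → ℝ, 0 ≤ 2 * adjQuad G x + (∑ v, x v) ^ 2)
    (hn : 277 ≤ Fintype.card V) (hd : ∀ v, G.degree v ≤ 4) :
    3 * (Module.finrank ℝ (seidelKer G) + 1) ≤ Fintype.card V := by
  by_contra hgoal
  have hd3 : ∀ v, G.degree v ≤ 3 := by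
    by_contra! ⟨v, hv⟩
    have hv4 : G.degree v = 4 := by have := hd v; omega
    refine hgoal (finrank_seidelKer_of_nonpos_small hM hn hd
      (h := fun w => nbrInd G v w + 2 * (Pi.single v 1 : V → ℝ) w)
      (U := insert v (G.neighborFinset v)) ?_ ?_ ?_ ?_)
    · rw [Finset.sum_add_distrib, ← Finset.mul_sum, sum_nbrInd, hv4]
      simp
      norm_num
    · intro w hw
      by_contra hcon
      simp only [Finset.mem_insert, SimpleGraph.mem_neighborFinset, not_or] at hcon
      simp [nbrInd, hcon] at hw
    · refine (Finset.card_insert_le _ _).trans ?_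
      rw [SimpleGraph.card_neighborFinset_eq_degree]
      omega
    · have := adjQuad_star (G := G) v
      rw [hv4] at this
      push_cast at this
      linarith
  have key : ∀ u v, u ≠ v → G.degree u = 3 → G.degree v = 3 → ∀ α : ℝ, 0 ≤ α →
      0 < adjQuad G (fun w => (nbrInd G u w + nbrInd G v w)
        + α * ((Pi.single u 1 : V → ℝ) w + (Pi.single v 1 : V → ℝ) w)) := by
    intro u v huv hu hv α hα
    by_contra hq
    refine hgoal (finrank_seidelKer_of_nonpos_small hM hn hd
      (U := insert u (G.neighborFinset u) ∪ insert v (G.neighborFinset v)) ?_ ?_ ?_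
      (not_lt.1 hq))
    · rw [Finset.sum_add_distrib, ← Finset.mul_sum, Finset.sum_add_distrib, Finset.sum_add_distrib,
        sum_nbrInd, sum_nbrInd, hu, hv]
      simp
      positivity
    · intro w hw
      by_contra hcon
      simp only [Finset.mem_union, Finset.mem_insert, SimpleGraph.mem_neighborFinset,
        not_or] at hcon
      simp [nbrInd, hcon] at hw
    · refine (Finset.card_union_le _ _).trans ?_
      have h1 := Finset.card_insert_le u (G.neighborFinset u)
      have h2 := Finset.card_insert_le v (G.neighborFinset v)
      rw [SimpleGraph.card_neighborFinset_eq_degree] at h1 h2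
      omega
  have hadj : ∀ u v, G.degree u = 3 → G.degree v = 3 → ¬ G.Adj u v := by
    intro u v hu hv huv
    -- With centre weight 1 the degree terms cancel, and at least five walks of length 3 from `u` to
    -- `v` bring the bound to `4 + 6 - 10 = 0`.
    have h1 := key u v huv.ne hu hv 1 zero_le_one
    have h2 := adjQuad_doubleStar (G := G) huv.ne 1
    rw [hu, hv, nbrInd_of_adj huv] at h2
    have h3 : (5 : ℝ) ≤ ∑ w ∈ G.neighborFinset u, ∑ x ∈ G.neighborFinset w, nbrInd G v x := by
      have hvu : v ∈ G.neighborFinset u := by simpa using huv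
      rw [← Finset.add_sum_erase _ _ hvu]
      have a1 : ∑ x ∈ G.neighborFinset v, nbrInd G v x = 3 := by
        rw [Finset.sum_congr rfl fun x hx => nbrInd_of_adj (by simpa using hx)]
        simp [hv]
      have a2 : ∑ w ∈ (G.neighborFinset u).erase v, (1 : ℝ) ≤
          ∑ w ∈ (G.neighborFinset u).erase v, ∑ x ∈ G.neighborFinset w, nbrInd G v x := by
        refine Finset.sum_le_sum fun w hw => ?_
        have hwu : u ∈ G.neighborFinset w := by
          simpa using (show G.Adj u w by simpa using Finset.mem_of_mem_erase hw).symm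
        rw [← nbrInd_of_adj huv.symm]
        exact Finset.single_le_sum (f := fun x => nbrInd G v x)
          (fun x _ => nbrInd_nonneg v x) hwu
      have a3 : ∑ w ∈ (G.neighborFinset u).erase v, (1 : ℝ) = 2 := by
        rw [Finset.sum_const, Finset.card_erase_of_mem hvu,
          SimpleGraph.card_neighborFinset_eq_degree, hu]
        norm_num
      linarith
    push_cast at h2
    linarith
  refine hgoal (finrank_seidelKer_of_separated hM (by omega) hd3 hadj ?_)
  intro u v w hu hv huv huw hvw
  -- With centre weight 2 and a common neighbour the bound is at most `-2 * 8 + 16 = 0`.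
  have h1 := key u v huv hu hv 2 zero_le_two
  have h2 := adjQuad_doubleStar (G := G) huv 2
  have h0 : nbrInd G u v = 0 := if_neg (hadj u v hu hv)
  have h3 : (1 : ℝ) ≤ ∑ w ∈ G.neighborFinset u, nbrInd G v w := by
    rw [← nbrInd_of_adj hvw]
    exact Finset.single_le_sum (f := fun x => nbrInd G v x) (fun x _ => nbrInd_nonneg v x)
      (by simpa using huw)
  have h4 : 0 ≤ ∑ w ∈ G.neighborFinset u, ∑ x ∈ G.neighborFinset w, nbrInd G v x :=
    Finset.sum_nonneg fun _ _ => Finset.sum_nonneg fun _ _ => nbrInd_nonneg _ _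
  rw [hu, hv, h0] at h2
  norm_num at h2
  linarith

end DegreeAtMostFour

/-! ### Five-leaf stars and elimination of a 29-coclique. -/

section Coclique

variable {V : Type*} [Fintype V] [DecidableEq V] {G : SimpleGraph V} [DecidableRel G.Adj]

/-- The indicator function of a finite set. -/
def finsetInd (Y : Finset V) (w : V) : ℝ := if w ∈ Y then 1 else 0

lemma sum_finsetInd (Y : Finset V) : ∑ w, finsetInd Y w = #Y := by
  simp [finsetInd]

lemma sum_finsetInd_subset (X Y : Finset V) : ∑ w ∈ X, finsetInd Y w = #(X ∩ Y) := by
  simp [finsetInd]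

lemma adjQuad_finsetInd_le (Y : Finset V) : adjQuad G (finsetInd Y) ≤ 2 * #Y := by
  rw [adjQuad_eq, ← sum_finsetInd]
  have h1 : ∑ w, finsetInd Y w ^ 2 = ∑ w, finsetInd Y w :=
    Finset.sum_congr rfl fun w _ => by simp [finsetInd]
  have h2 : 0 ≤ ∑ w, ∑ u ∈ G.neighborFinset w, finsetInd Y w * finsetInd Y u :=
    Finset.sum_nonneg fun w _ => Finset.sum_nonneg fun u _ => by
      unfold finsetInd; split_ifs <;> norm_num
  rw [h1]
  linarith

lemma adjQuad_finsetInd_add_single_le {v : V} {Y : Finset V} (hY : Y ⊆ G.neighborFinset v)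
    (t : ℝ) : adjQuad G (fun w => finsetInd Y w + t * (Pi.single v 1 : V → ℝ) w) ≤
      2 * t ^ 2 + 2 * #Y - 2 * t * #Y := by
  have hv : v ∉ Y := fun h => by simpa using hY h
  rw [adjQuad_add_smul, adjBilin_single, adjQuad_single]
  have h1 : adjOp G (finsetInd Y) v = - #Y := by
    rw [adjOp, sum_finsetInd_subset, Finset.inter_eq_right.2 hY]
    simp [finsetInd, hv]
  rw [h1]
  linarith [adjQuad_finsetInd_le (G := G) Y]

/-- A star with five leaves and a small closed neighbourhood contradicts positivity. -/
lemma not_star_of_card (hM : ∀ x : V → ℝ, 0 ≤ 2 * adjQuad G x + (∑ v, x v) ^ 2) {v : V}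
    {Y Z : Finset V} (hY : Y ⊆ G.neighborFinset v) (hY5 : #Y = 5) (hvZ : v ∈ Z)
    (hNv : G.neighborFinset v ⊆ Z) (hNY : ∀ y ∈ Y, G.neighborFinset y ⊆ Z)
    (hZ : #Z + 46 ≤ Fintype.card V) : False := by
  have hw : (46 : ℝ) ≤ #Zᶜ := by
    rw [Finset.card_compl]
    exact_mod_cast (by omega : 46 ≤ Fintype.card V - #Z)
  set h : V → ℝ := fun w => finsetInd Y w + 2 * (Pi.single v 1 : V → ℝ) w
  have h1 : adjQuad G h ≤ -2 := by
    have := adjQuad_finsetInd_add_single_le hY 2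
    rw [hY5] at this
    push_cast at this
    linarith
  have h2 : ∑ w, h w = 7 := by
    simp only [h, Finset.sum_add_distrib, ← Finset.mul_sum, sum_finsetInd, hY5]
    simp
    norm_num
  have h3 : adjBilin G (finsetInd Zᶜ) h = 0 := by
    rw [adjBilin_comm]
    refine Finset.sum_eq_zero fun w _ => ?_
    have hcl : ∀ w, w ∈ Z → G.neighborFinset w ⊆ Z → adjOp G (finsetInd Zᶜ) w = 0 := by
      intro w hw hN
      rw [adjOp, sum_finsetInd_subset, Finset.disjoint_iff_inter_eq_empty.1
        (disjoint_compl_right.mono_left hN)]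
      simp [finsetInd, hw]
    by_cases hwv : w = v
    · rw [hwv, hcl v hvZ hNv, mul_zero]
    · by_cases hwY : w ∈ Y
      · rw [hcl w (hNv (hY hwY)) (hNY w hwY), mul_zero]
      · simp [h, finsetInd, hwv, hwY]
  have h4 := adjQuad_finsetInd_le (G := G) Zᶜ
  -- With `m = #Zᶜ`, this coefficient minimises `4 m t² + (7 - m t)²`, with minimum `196 / (m + 4)`.
  -- It is below 4 exactly when `m ≥ 46`.
  have h5 := hM (fun w => h w + (-(7 / (#Zᶜ + 4 : ℝ))) * finsetInd Zᶜ w)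
  rw [adjQuad_add_smul, h3, Finset.sum_add_distrib, ← Finset.mul_sum, h2, sum_finsetInd] at h5
  set m : ℝ := (#Zᶜ : ℝ)
  have hm : 0 < m + 4 := by linarith
  have h6 : (-(7 / (m + 4))) ^ 2 * adjQuad G (finsetInd Zᶜ) ≤ (-(7 / (m + 4))) ^ 2 * (2 * m) :=
    mul_le_mul_of_nonneg_left h4 (sq_nonneg _)
  have h7 : 2 * ((-(7 / (m + 4))) ^ 2 * (2 * m)) + (7 + -(7 / (m + 4)) * m) ^ 2 =
      196 / (m + 4) := by
    field_simp
    ring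
  have h8 : 196 / (m + 4) < 4 := by
    rw [div_lt_iff₀ hm]
    linarith
  linarith

/-- The form obtained by eliminating a coclique of size `29`. -/
lemma coclique_elimination (hM : ∀ x : V → ℝ, 0 ≤ 2 * adjQuad G x + (∑ v, x v) ^ 2)
    {A : Finset V} (hA : #A = 29) (hind : ∀ a ∈ A, ∀ b ∈ A, ¬ G.Adj a b) {x : V → ℝ}
    (hx : ∀ a ∈ A, x a = 0) {N : V → ℝ} (hN : ∀ b, N b = ∑ u ∈ G.neighborFinset b, x u) :
    0 ≤ 2 * adjQuad G x - ∑ b ∈ A, N b ^ 2 + (2 * ∑ v, x v + ∑ b ∈ A, N b) ^ 2 / 33 := by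
  -- The minimiser on the coclique is `N / 2` shifted by a constant; `33 = 29 + 4` comes from
  -- optimising the shift.
  set r : ℝ := (2 * ∑ v, x v + ∑ b ∈ A, N b) / 66 with hr
  set y : V → ℝ := fun v => if v ∈ A then N v / 2 - r else 0 with hy
  have h1 : adjBilin G y x = - ∑ b ∈ A, (N b / 2 - r) * N b := by
    rw [← Finset.sum_neg_distrib]
    simp only [adjBilin, adjOp, ← hN, hy, ite_mul, zero_mul, Finset.sum_ite_mem, Finset.univ_inter]
    exact Finset.sum_congr rfl fun a ha => by rw [hx a ha]; ring
  have h2 : adjQuad G y = 2 * ∑ b ∈ A, (N b / 2 - r) ^ 2 := by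
    rw [adjQuad_eq]
    have e : ∑ v, ∑ u ∈ G.neighborFinset v, y v * y u = 0 := by
      refine Finset.sum_eq_zero fun v _ => Finset.sum_eq_zero fun u hu => ?_
      by_cases hv : v ∈ A
      · have hu' : u ∉ A := fun hu' => hind v hv u hu' (by simpa using hu)
        simp [hy, hu']
      · simp [hy, hv]
    rw [e, sub_zero]
    simp [hy, ite_pow, Finset.sum_ite_mem]
  have h3 : ∑ v, y v = (∑ b ∈ A, N b) / 2 - 29 * r := by
    simp [hy, Finset.sum_ite_mem, Finset.sum_sub_distrib, Finset.sum_div, hA]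
  have h4 := hM (fun v => x v + 1 * y v)
  rw [adjQuad_add_smul, Finset.sum_add_distrib, ← Finset.mul_sum, h1, h2, h3] at h4
  have h5 : 2 * (2 * 1 * (- ∑ b ∈ A, (N b / 2 - r) * N b)
      + 1 ^ 2 * (2 * ∑ b ∈ A, (N b / 2 - r) ^ 2)) = 116 * r ^ 2 - ∑ b ∈ A, N b ^ 2 := by
    have : (116 : ℝ) * r ^ 2 = ∑ b ∈ A, 4 * r ^ 2 := by
      rw [Finset.sum_const, hA, nsmul_eq_mul]; push_cast; ring
    rw [this]
    simp only [Finset.mul_sum, ← Finset.sum_neg_distrib, ← Finset.sum_add_distrib,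
      ← Finset.sum_sub_distrib]
    exact Finset.sum_congr rfl fun b _ => by ring
  have h6 : (2 * ∑ v, x v + ∑ b ∈ A, N b) ^ 2 / 33 =
      116 * r ^ 2 + (∑ v, x v + 1 * ((∑ b ∈ A, N b) / 2 - 29 * r)) ^ 2 := by
    rw [hr]; ring
  rw [h6]
  linarith

lemma sum_card_inter_comm (A Y : Finset V) :
    ∑ b ∈ A, #(G.neighborFinset b ∩ Y) = ∑ y ∈ Y, #(G.neighborFinset y ∩ A) := by
  have h := Finset.sum_card_bipartiteAbove_eq_sum_card_bipartiteBelow (s := A) (t := Y) G.Adj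
  have h1 : ∀ b, Finset.bipartiteAbove G.Adj Y b = G.neighborFinset b ∩ Y := by
    intro b; ext y; simp [Finset.mem_bipartiteAbove, and_comm]
  have h2 : ∀ y, Finset.bipartiteBelow G.Adj A y = G.neighborFinset y ∩ A := by
    intro y; ext b; simp [Finset.mem_bipartiteBelow, and_comm, G.adj_comm]
  simpa only [h1, h2] using h

lemma coclique_set (hM : ∀ x : V → ℝ, 0 ≤ 2 * adjQuad G x + (∑ v, x v) ^ 2)
    {A : Finset V} (hA : #A = 29) (hind : ∀ a ∈ A, ∀ b ∈ A, ¬ G.Adj a b) {Y : Finset V}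
    (hY : Disjoint Y A) :
    0 ≤ 4 * (#Y : ℝ) - ∑ b ∈ A, (#(G.neighborFinset b ∩ Y) : ℝ) ^ 2
      + (2 * #Y + ∑ b ∈ A, (#(G.neighborFinset b ∩ Y) : ℝ)) ^ 2 / 33 := by
  have h := coclique_elimination hM hA hind (x := finsetInd Y)
    (fun a ha => if_neg (Finset.disjoint_right.1 hY ha)) (fun b => (sum_finsetInd_subset _ Y).symm)
  rw [sum_finsetInd] at h
  linarith [adjQuad_finsetInd_le (G := G) Y]

lemma coclique_star (hM : ∀ x : V → ℝ, 0 ≤ 2 * adjQuad G x + (∑ v, x v) ^ 2)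
    {A : Finset V} (hA : #A = 29) (hind : ∀ a ∈ A, ∀ b ∈ A, ¬ G.Adj a b) {v : V} (hv : v ∉ A)
    {Y : Finset V} (hYv : Y ⊆ G.neighborFinset v) (hY : Disjoint Y A) (t : ℝ) :
    0 ≤ 4 * t ^ 2 + 4 * (#Y : ℝ) - 4 * t * #Y
      - ∑ b ∈ A, (#(G.neighborFinset b ∩ Y) + t * nbrInd G v b) ^ 2
      + (2 * (#Y + t) + ∑ b ∈ A, (#(G.neighborFinset b ∩ Y) + t * nbrInd G v b)) ^ 2 / 33 := by
  have h := coclique_elimination hM hA hind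
    (x := fun w => finsetInd Y w + t * (Pi.single v 1 : V → ℝ) w)
    (fun a ha => by
      have : a ≠ v := fun h => hv (h ▸ ha)
      simp [finsetInd, Finset.disjoint_right.1 hY ha, this])
    (N := fun b => #(G.neighborFinset b ∩ Y) + t * nbrInd G v b) (fun b => by
      rw [Finset.sum_add_distrib, sum_finsetInd_subset, ← Finset.mul_sum, ← nbrInd_eq_sum])
  have h1 : ∑ w, (finsetInd Y w + t * (Pi.single v 1 : V → ℝ) w) = #Y + t := by
    rw [Finset.sum_add_distrib, ← Finset.mul_sum, sum_finsetInd]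
    simp
  rw [h1] at h
  linarith [adjQuad_finsetInd_add_single_le hYv t]

lemma sum_nbrInd_coclique (v : V) (A : Finset V) :
    ∑ b ∈ A, nbrInd G v b = #(G.neighborFinset v ∩ A) := by
  simp [nbrInd, Finset.inter_comm, Finset.sum_boole, ← Finset.filter_mem_eq_inter]

lemma sq_ge_sum_nbrInd (A Y : Finset V) (v : V) {t : ℝ} (ht : 0 ≤ t) :
    ∑ b ∈ A, (#(G.neighborFinset b ∩ Y) : ℝ) ^ 2 + t ^ 2 * #(G.neighborFinset v ∩ A) ≤
      ∑ b ∈ A, (#(G.neighborFinset b ∩ Y) + t * nbrInd G v b) ^ 2 := by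
  rw [← sum_nbrInd_coclique, Finset.mul_sum, ← Finset.sum_add_distrib]
  refine Finset.sum_le_sum fun b _ => ?_
  have h1 : nbrInd G v b ^ 2 = nbrInd G v b := by unfold nbrInd; split_ifs <;> norm_num
  have h2 : (0 : ℝ) ≤ #(G.neighborFinset b ∩ Y) * (t * nbrInd G v b) :=
    mul_nonneg (Nat.cast_nonneg _) (mul_nonneg ht (nbrInd_nonneg _ _))
  nlinarith

/-- No integer lies strictly between `c` and `c + 1`, so the chord there bounds the square. It is
sharpest with `c` near the average of the counts. -/
lemma natCast_sq_ge (d c : ℕ) : (2 * (c : ℝ) + 1) * d - c * (c + 1) ≤ (d : ℝ) ^ 2 := by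
  have h : 0 ≤ ((d : ℤ) - c) * (d - c - 1) := by
    rcases lt_or_ge (c : ℤ) d with h | h
    · exact mul_nonneg (by omega) (by omega)
    · exact mul_nonneg_of_nonpos_of_nonpos (by omega) (by omega)
  have : (0 : ℝ) ≤ ((d : ℝ) - c) * (d - c - 1) := by exact_mod_cast h
  linarith

/-- The quadratic inequality for a star centred outside the coclique. -/
lemma coclique_star_count (hM : ∀ x : V → ℝ, 0 ≤ 2 * adjQuad G x + (∑ v, x v) ^ 2)
    {A : Finset V} (hA : #A = 29) (hind : ∀ a ∈ A, ∀ b ∈ A, ¬ G.Adj a b) {v : V} (hv : v ∉ A)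
    {Y : Finset V} (hYv : Y ⊆ G.neighborFinset v) (hY : Disjoint Y A) {t : ℝ} (ht : 0 ≤ t)
    {k s D : ℝ} (hk : #(G.neighborFinset v ∩ A) = k) (hs : #Y = s)
    (hD : ∑ y ∈ Y, (#(G.neighborFinset y ∩ A) : ℝ) = D) :
    0 ≤ 4 * t ^ 2 + 4 * s - 4 * t * s - t ^ 2 * k - D + (2 * (s + t) + (D + t * k)) ^ 2 / 33 := by
  have h1 := coclique_star hM hA hind hv hYv hY t
  have h2 := sq_ge_sum_nbrInd (G := G) A Y v ht
  have h3 : ∑ b ∈ A, (#(G.neighborFinset b ∩ Y) : ℝ) = D := by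
    rw [← hD]; exact_mod_cast sum_card_inter_comm (G := G) A Y
  have h4 : D ≤ ∑ b ∈ A, (#(G.neighborFinset b ∩ Y) : ℝ) ^ 2 := by
    rw [← h3]
    exact Finset.sum_le_sum fun b _ => by simpa using natCast_sq_ge #(G.neighborFinset b ∩ Y) 0
  rw [Finset.sum_add_distrib, ← Finset.mul_sum, sum_nbrInd_coclique, h3, hk, hs] at h1
  rw [hk] at h2
  linarith

/-- The quadratic inequality for a star centred in the coclique. -/
lemma coclique_center_count (hM : ∀ x : V → ℝ, 0 ≤ 2 * adjQuad G x + (∑ v, x v) ^ 2)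
    {A : Finset V} (hA : #A = 29) (hind : ∀ a ∈ A, ∀ b ∈ A, ¬ G.Adj a b) {a : V} (ha : a ∈ A)
    {Y : Finset V} (hYa : Y ⊆ G.neighborFinset a) (c : ℕ) {s D : ℝ} (hs : #Y = s)
    (hD : ∑ y ∈ Y, (#(G.neighborFinset y ∩ A) : ℝ) = D) :
    s ≤ D ∧
    0 ≤ 4 * s - s ^ 2 - ((2 * c + 1) * (D - s) - 28 * (c * (c + 1))) + (2 * s + D) ^ 2 / 33 := by
  have hY : Disjoint Y A := Finset.disjoint_left.2 fun y hy hyA =>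
    hind a ha y hyA (by simpa using hYa hy)
  have h1 := coclique_set hM hA hind hY
  have h3 : ∑ b ∈ A, (#(G.neighborFinset b ∩ Y) : ℝ) = D := by
    rw [← hD]; exact_mod_cast sum_card_inter_comm (G := G) A Y
  rw [hs, h3, ← Finset.add_sum_erase _ _ ha, Finset.inter_eq_right.2 hYa, hs] at h1
  rw [← Finset.add_sum_erase _ _ ha, Finset.inter_eq_right.2 hYa, hs] at h3
  have h4 : ∑ b ∈ A.erase a, ((2 * (c : ℝ) + 1) * #(G.neighborFinset b ∩ Y) - c * (c + 1)) ≤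
      ∑ b ∈ A.erase a, (#(G.neighborFinset b ∩ Y) : ℝ) ^ 2 :=
    Finset.sum_le_sum fun b _ => natCast_sq_ge _ c
  rw [Finset.sum_sub_distrib, ← Finset.mul_sum, Finset.sum_const, Finset.card_erase_of_mem ha,
    hA, nsmul_eq_mul] at h4
  push_cast at h4
  have h5 : ∑ b ∈ A.erase a, (#(G.neighborFinset b ∩ Y) : ℝ) = D - s := by linarith
  have h6 : 0 ≤ D - s := h5 ▸ Finset.sum_nonneg fun _ _ => Nat.cast_nonneg _
  rw [h5] at h4
  exact ⟨by linarith, by linarith⟩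

end Coclique

/-! ### From coclique inequalities to maximum degree 4. -/

section DegreeBound

variable {V : Type*} [Fintype V] [DecidableEq V] {G : SimpleGraph V} [DecidableRel G.Adj]

lemma coclique_degree_le_five (hM : ∀ x : V → ℝ, 0 ≤ 2 * adjQuad G x + (∑ v, x v) ^ 2)
    {A : Finset V} (hA : #A = 29) (hind : ∀ a ∈ A, ∀ b ∈ A, ¬ G.Adj a b) {v : V} (hv : v ∉ A)
    (hk : #(G.neighborFinset v ∩ A) ≤ 14) : #(G.neighborFinset v ∩ A) ≤ 5 := by
  have h := coclique_star_count hM hA hind hv (Y := ∅) (Finset.empty_subset _)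
    (Finset.disjoint_empty_left _) zero_le_one rfl (s := 0) (D := 0) (by simp) (by simp)
  generalize #(G.neighborFinset v ∩ A) = k at h hk ⊢
  by_contra hcon
  -- The inequality `4 - k + (k + 2)² / 33 ≥ 0` fails for every `k` from 6 to 14; the balanced
  -- switching is what rules out large `k`.
  interval_cases k <;> norm_num at *

lemma coclique_center_le_of_le_five (hM : ∀ x : V → ℝ, 0 ≤ 2 * adjQuad G x + (∑ v, x v) ^ 2)
    {A : Finset V} (hA : #A = 29) (hind : ∀ a ∈ A, ∀ b ∈ A, ¬ G.Adj a b)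
    (hk : ∀ v ∉ A, #(G.neighborFinset v ∩ A) ≤ 5) {a : V} (ha : a ∈ A) : G.degree a ≤ 44 := by
  by_contra! hcon
  rw [← SimpleGraph.card_neighborFinset_eq_degree] at hcon
  obtain ⟨Y, hY, hYc⟩ := Finset.exists_subset_card_eq hcon
  have hYA : ∀ y ∈ Y, y ∉ A := fun y hy hyA => hind a ha y hyA (by simpa using hY hy)
  -- At most `45 * 4 = 180` edges go from `Y` to the other 28 coclique vertices, between 6 and 7 on
  -- average.
  obtain ⟨h0, h⟩ := coclique_center_count hM hA hind ha hY 6 rfl rfl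
  have h1 : ∑ y ∈ Y, (#(G.neighborFinset y ∩ A) : ℝ) ≤ ∑ y ∈ Y, 5 :=
    Finset.sum_le_sum fun y hy => by exact_mod_cast hk y (hYA y hy)
  rw [Finset.sum_const, hYc] at h1
  rw [hYc] at h h0
  generalize ∑ y ∈ Y, (#(G.neighborFinset y ∩ A) : ℝ) = D at h h0 h1
  norm_num at h h0 h1
  nlinarith [mul_nonneg (sub_nonneg.2 h0) (sub_nonneg.2 h1)]

lemma coclique_center_le_of_le_four (hM : ∀ x : V → ℝ, 0 ≤ 2 * adjQuad G x + (∑ v, x v) ^ 2)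
    {A : Finset V} (hA : #A = 29) (hind : ∀ a ∈ A, ∀ b ∈ A, ¬ G.Adj a b)
    (hk : ∀ v ∉ A, #(G.neighborFinset v ∩ A) ≤ 4) {a : V} (ha : a ∈ A) : G.degree a ≤ 37 := by
  by_contra! hcon
  rw [← SimpleGraph.card_neighborFinset_eq_degree] at hcon
  obtain ⟨Y, hY, hYc⟩ := Finset.exists_subset_card_eq hcon
  have hYA : ∀ y ∈ Y, y ∉ A := fun y hy hyA => hind a ha y hyA (by simpa using hY hy)
  obtain ⟨h0, h⟩ := coclique_center_count hM hA hind ha hY 4 rfl rfl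
  have h1 : ∑ y ∈ Y, (#(G.neighborFinset y ∩ A) : ℝ) ≤ ∑ y ∈ Y, 4 :=
    Finset.sum_le_sum fun y hy => by exact_mod_cast hk y (hYA y hy)
  rw [Finset.sum_const, hYc] at h1
  rw [hYc] at h h0
  generalize ∑ y ∈ Y, (#(G.neighborFinset y ∩ A) : ℝ) = D at h h0 h1
  norm_num at h h0 h1
  nlinarith [mul_nonneg (sub_nonneg.2 h0) (sub_nonneg.2 h1)]

/-- Two common neighbours of a vertex that both have four neighbours in the coclique have no
common neighbour there. -/
lemma coclique_four_disjoint (hM : ∀ x : V → ℝ, 0 ≤ 2 * adjQuad G x + (∑ v, x v) ^ 2)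
    {A : Finset V} (hA : #A = 29) (hind : ∀ a ∈ A, ∀ b ∈ A, ¬ G.Adj a b)
    (hk : ∀ v ∉ A, #(G.neighborFinset v ∩ A) ≤ 5) {v y z : V} (hv : v ∉ A) (hy : y ∉ A)
    (hz : z ∉ A) (hvy : G.Adj v y) (hvz : G.Adj v z) (hyz : y ≠ z)
    (hky : #(G.neighborFinset y ∩ A) = 4) (hkz : #(G.neighborFinset z ∩ A) = 4) :
    Disjoint (G.neighborFinset y ∩ A) (G.neighborFinset z ∩ A) := by
  rw [Finset.disjoint_left]
  intro b hb1 hb2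
  simp only [Finset.mem_inter, SimpleGraph.mem_neighborFinset] at hb1 hb2
  have hYv : ({y, z} : Finset V) ⊆ G.neighborFinset v := by
    intro w hw
    rcases Finset.mem_insert.1 hw with rfl | hw
    · simpa using hvy
    · rw [Finset.mem_singleton.1 hw]; simpa using hvz
  have hYA : Disjoint ({y, z} : Finset V) A := by
    rw [Finset.disjoint_left]
    intro w hw
    rcases Finset.mem_insert.1 hw with rfl | hw
    · exact hy
    · rw [Finset.mem_singleton.1 hw]; exact hz
  have hYc : #({y, z} : Finset V) = 2 := Finset.card_pair hyz
  have h1 := coclique_star hM hA hind hv hYv hYA 1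
  have h2 := sq_ge_sum_nbrInd (G := G) A {y, z} v zero_le_one
  have h3 : ∑ b ∈ A, (#(G.neighborFinset b ∩ {y, z}) : ℝ) = 8 := by
    have := sum_card_inter_comm (G := G) A {y, z}
    rw [Finset.sum_pair hyz, hky, hkz] at this
    exact_mod_cast this
  have hb : #(G.neighborFinset b ∩ {y, z}) = 2 := by
    rw [Finset.inter_eq_right.2, hYc]
    intro w hw
    rcases Finset.mem_insert.1 hw with rfl | hw
    · simpa using hb1.1.symm
    · rw [Finset.mem_singleton.1 hw]; simpa using hb2.1.symm
  -- A shared neighbour contributes 4 instead of 2, raising the sum of squares from 8 to 10.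
  have h4 : (10 : ℝ) ≤ ∑ b ∈ A, (#(G.neighborFinset b ∩ {y, z}) : ℝ) ^ 2 := by
    rw [← Finset.add_sum_erase _ _ hb1.2, hb] at h3 ⊢
    have : ∑ b ∈ A.erase b, (#(G.neighborFinset b ∩ {y, z}) : ℝ) ≤
        ∑ b ∈ A.erase b, (#(G.neighborFinset b ∩ {y, z}) : ℝ) ^ 2 :=
      Finset.sum_le_sum fun b _ => by simpa using natCast_sq_ge #(G.neighborFinset b ∩ {y, z}) 0
    push_cast at h3 ⊢
    linarith
  have hkv := hk v hv
  rw [Finset.sum_add_distrib, ← Finset.mul_sum, sum_nbrInd_coclique, h3, hYc] at h1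
  generalize #(G.neighborFinset v ∩ A) = k at h1 h2 hkv
  generalize ∑ b ∈ A, (#(G.neighborFinset b ∩ {y, z}) + 1 * nbrInd G v b) ^ 2 = W at h1 h2
  interval_cases k <;> norm_num at * <;> linarith

lemma card_four_neighbors_le (hM : ∀ x : V → ℝ, 0 ≤ 2 * adjQuad G x + (∑ v, x v) ^ 2)
    {A : Finset V} (hA : #A = 29) (hind : ∀ a ∈ A, ∀ b ∈ A, ¬ G.Adj a b)
    (hk : ∀ v ∉ A, #(G.neighborFinset v ∩ A) ≤ 5) {v : V} (hv : v ∉ A) {Y : Finset V}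
    (hYv : Y ⊆ G.neighborFinset v) (hYA : Disjoint Y A)
    (hY4 : ∀ y ∈ Y, #(G.neighborFinset y ∩ A) = 4) : #Y ≤ 7 := by
  have h : #(Y.biUnion fun y => G.neighborFinset y ∩ A) = #Y * 4 := by
    rw [Finset.card_biUnion, Finset.sum_const_nat hY4]
    intro y hy z hz hyz
    exact coclique_four_disjoint hM hA hind hk hv (Finset.disjoint_left.1 hYA hy)
      (Finset.disjoint_left.1 hYA hz) (by simpa using hYv hy) (by simpa using hYv hz) hyz
      (hY4 y hy) (hY4 z hz)
  have h2 : #(Y.biUnion fun y => G.neighborFinset y ∩ A) ≤ #A :=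
    Finset.card_le_card (Finset.biUnion_subset.2 fun _ _ => Finset.inter_subset_right)
  omega

lemma coclique_neighbor_of_five (hM : ∀ x : V → ℝ, 0 ≤ 2 * adjQuad G x + (∑ v, x v) ^ 2)
    {A : Finset V} (hA : #A = 29) (hind : ∀ a ∈ A, ∀ b ∈ A, ¬ G.Adj a b)
    (hk : ∀ v ∉ A, #(G.neighborFinset v ∩ A) ≤ 5) {v z : V} (hv : v ∉ A) (hz : z ∉ A)
    (hvz : G.Adj v z) (hkv : #(G.neighborFinset v ∩ A) = 5) :
    #(G.neighborFinset z ∩ A) = 4 := by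
  have hc : ∀ t : ℝ, 0 ≤ t → _ := fun t ht =>
    coclique_star_count hM hA hind hv (Y := {z}) (by simpa using hvz) (by simpa using hz) ht
      (s := 1) (by rw [hkv]) (by simp) (by rw [Finset.sum_singleton])
  -- Centre weight 1 excludes five coclique neighbours of `z`; weight 2 excludes at most three.
  have h1 := hc 1 zero_le_one
  have h2 := hc 2 zero_le_two
  have hkz := hk z hz
  generalize #(G.neighborFinset z ∩ A) = k at h1 h2 hkz ⊢
  interval_cases k <;> norm_num at *

lemma degree_eq_coclique_add (A : Finset V) (v : V) :
    G.degree v = #(G.neighborFinset v ∩ A) + #(G.neighborFinset v \ A) := by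
  rw [← SimpleGraph.card_neighborFinset_eq_degree, add_comm, Finset.card_sdiff_add_card_inter]

lemma coclique_degree_le_four (hM : ∀ x : V → ℝ, 0 ≤ 2 * adjQuad G x + (∑ v, x v) ^ 2)
    (hn : 277 ≤ Fintype.card V)
    {A : Finset V} (hA : #A = 29) (hind : ∀ a ∈ A, ∀ b ∈ A, ¬ G.Adj a b)
    (hk : ∀ v ∉ A, #(G.neighborFinset v ∩ A) ≤ 5) {v : V} (hv : v ∉ A) :
    #(G.neighborFinset v ∩ A) ≤ 4 := by
  by_contra! hcon
  have hkv : #(G.neighborFinset v ∩ A) = 5 := le_antisymm (hk v hv) hcon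
  have h7 : #(G.neighborFinset v \ A) ≤ 7 := by
    refine card_four_neighbors_le hM hA hind hk hv Finset.sdiff_subset Finset.sdiff_disjoint ?_
    intro y hy
    rw [Finset.mem_sdiff, SimpleGraph.mem_neighborFinset] at hy
    exact coclique_neighbor_of_five hM hA hind hk hv hy.2 hy.1 hkv
  have hdv := degree_eq_coclique_add (G := G) A v
  set Y := G.neighborFinset v ∩ A
  -- The leaves are the five coclique neighbours, each of degree at most 44. Since `v` has degree at
  -- most 12, `Z` has at most `1 + 12 + 5 * 43 = 228` vertices.
  refine not_star_of_card hM (Y := Y)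
    (Z := insert v (G.neighborFinset v ∪ Y.biUnion fun a => (G.neighborFinset a).erase v))
    Finset.inter_subset_left hkv (Finset.mem_insert_self _ _)
    (fun w hw => Finset.mem_insert_of_mem (Finset.mem_union_left _ hw)) ?_ ?_
  · intro a ha w hw
    by_cases hwv : w = v
    · rw [hwv]; exact Finset.mem_insert_self _ _
    · exact Finset.mem_insert_of_mem (Finset.mem_union_right _
        (Finset.mem_biUnion.2 ⟨a, ha, Finset.mem_erase.2 ⟨hwv, hw⟩⟩))
  · have h1 := Finset.card_insert_le v
      (G.neighborFinset v ∪ Y.biUnion fun a => (G.neighborFinset a).erase v)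
    have h2 := Finset.card_union_le (G.neighborFinset v)
      (Y.biUnion fun a => (G.neighborFinset a).erase v)
    have h3 : #(Y.biUnion fun a => (G.neighborFinset a).erase v) ≤ #Y * 43 := by
      refine Finset.card_biUnion_le_card_mul _ _ _ fun a ha => ?_
      obtain ⟨hav, haA⟩ := Finset.mem_inter.1 ha
      have := coclique_center_le_of_le_five hM hA hind hk haA
      rw [Finset.card_erase_of_mem (by simpa using (G.adj_symm (by simpa using hav))),
        SimpleGraph.card_neighborFinset_eq_degree]
      omega
    rw [SimpleGraph.card_neighborFinset_eq_degree] at h2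
    omega

lemma card_le_of_few_coclique_neighbors
    (hM : ∀ x : V → ℝ, 0 ≤ 2 * adjQuad G x + (∑ v, x v) ^ 2)
    {A : Finset V} (hA : #A = 29) (hind : ∀ a ∈ A, ∀ b ∈ A, ¬ G.Adj a b) {v : V} (hv : v ∉ A)
    (hkv : #(G.neighborFinset v ∩ A) ≤ 2) {Y : Finset V} (hYv : Y ⊆ G.neighborFinset v)
    (hYA : Disjoint Y A) (hY3 : ∀ y ∈ Y, #(G.neighborFinset y ∩ A) ≤ 3) : #Y ≤ 28 := by
  by_contra! hcon
  obtain ⟨X, hX, hXc⟩ := Finset.exists_subset_card_eq hcon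
  have h := coclique_star hM hA hind hv (hX.trans hYv) (hYA.mono_left hX) 10
  set n : V → ℕ := fun b => #(G.neighborFinset b ∩ X) + 10 * if G.Adj v b then 1 else 0 with hn
  have hnb : ∀ b, (#(G.neighborFinset b ∩ X) + 10 * nbrInd G v b : ℝ) = n b := by
    intro b
    simp [hn, nbrInd]
  simp only [hnb] at h
  -- The total is at most `29 * 3 + 10 * 2 = 107` over 29 vertices, so averages between 3 and 4 are
  -- the critical ones.
  have h1 : ∑ b ∈ A, (7 * (n b : ℝ) - 12) ≤ ∑ b ∈ A, (n b : ℝ) ^ 2 :=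
    Finset.sum_le_sum fun b _ => by have := natCast_sq_ge (n b) 3; norm_num at this ⊢; linarith
  rw [Finset.sum_sub_distrib, ← Finset.mul_sum, Finset.sum_const, hA] at h1
  have h2 : ∑ b ∈ A, (n b : ℝ) ≤ 107 := by
    have e1 : ∑ b ∈ A, (n b : ℝ) = ((∑ b ∈ A, #(G.neighborFinset b ∩ X) : ℕ) : ℝ)
        + 10 * #(G.neighborFinset v ∩ A) := by
      rw [← sum_nbrInd_coclique, Finset.mul_sum, Nat.cast_sum, ← Finset.sum_add_distrib]
      exact Finset.sum_congr rfl fun b _ => (hnb b).symm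
    have e2 : ∑ b ∈ A, #(G.neighborFinset b ∩ X) ≤ 87 := by
      rw [sum_card_inter_comm]
      refine (Finset.sum_le_card_nsmul X _ 3 fun y hy => hY3 y (hX hy)).trans ?_
      simp [hXc]
    rw [e1]
    exact_mod_cast (by omega : ∑ b ∈ A, #(G.neighborFinset b ∩ X)
      + 10 * #(G.neighborFinset v ∩ A) ≤ 107)
  have h0 : (0 : ℝ) ≤ ∑ b ∈ A, (n b : ℝ) := Finset.sum_nonneg fun _ _ => Nat.cast_nonneg _
  rw [hXc] at h
  generalize ∑ b ∈ A, (n b : ℝ) ^ 2 = W at h h1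
  generalize ∑ b ∈ A, (n b : ℝ) = D at h h0 h1 h2
  norm_num at h h1
  nlinarith [mul_nonneg h0 (sub_nonneg.2 h2)]

lemma card_le_of_many_coclique_neighbors
    (hM : ∀ x : V → ℝ, 0 ≤ 2 * adjQuad G x + (∑ v, x v) ^ 2)
    {A : Finset V} (hA : #A = 29) (hind : ∀ a ∈ A, ∀ b ∈ A, ¬ G.Adj a b) {v : V} (hv : v ∉ A)
    (hkv : 3 ≤ #(G.neighborFinset v ∩ A)) (hkv' : #(G.neighborFinset v ∩ A) ≤ 4)
    {Y : Finset V} (hYv : Y ⊆ G.neighborFinset v)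
    (hYA : Disjoint Y A) (hY3 : ∀ y ∈ Y, #(G.neighborFinset y ∩ A) ≤ 3) : #Y ≤ 9 := by
  by_contra! hcon
  obtain ⟨X, hX, hXc⟩ := Finset.exists_subset_card_eq hcon
  have h := coclique_star_count hM hA hind hv (hX.trans hYv) (hYA.mono_left hX) (t := 7)
    (by norm_num) rfl (s := 10) (by rw [hXc]; norm_num) rfl
  have h2 : ∑ y ∈ X, (#(G.neighborFinset y ∩ A) : ℝ) ≤ ∑ y ∈ X, 3 :=
    Finset.sum_le_sum fun y hy => by exact_mod_cast hY3 y (hX hy)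
  have h0 : (0 : ℝ) ≤ ∑ y ∈ X, (#(G.neighborFinset y ∩ A) : ℝ) :=
    Finset.sum_nonneg fun _ _ => Nat.cast_nonneg _
  rw [Finset.sum_const, hXc] at h2
  generalize ∑ y ∈ X, (#(G.neighborFinset y ∩ A) : ℝ) = D at h h0 h2
  generalize #(G.neighborFinset v ∩ A) = k at h hkv hkv'
  norm_num at h2
  interval_cases k <;> norm_num at h <;> nlinarith [mul_nonneg h0 (sub_nonneg.2 h2)]

lemma degree_le_of_coclique (hM : ∀ x : V → ℝ, 0 ≤ 2 * adjQuad G x + (∑ v, x v) ^ 2)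
    {A : Finset V} (hA : #A = 29) (hind : ∀ a ∈ A, ∀ b ∈ A, ¬ G.Adj a b)
    (hk : ∀ v ∉ A, #(G.neighborFinset v ∩ A) ≤ 4) (v : V) : G.degree v ≤ 37 := by
  by_cases hv : v ∈ A
  · exact coclique_center_le_of_le_four hM hA hind hk hv
  have hdv := degree_eq_coclique_add (G := G) A v
  have hsp := Finset.card_filter_add_card_filter_not (s := G.neighborFinset v \ A)
    (fun y => #(G.neighborFinset y ∩ A) = 4)
  have hsub : ∀ p : V → Prop, ∀ [DecidablePred p],
      (G.neighborFinset v \ A).filter p ⊆ G.neighborFinset v :=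
    fun p _ => (Finset.filter_subset _ _).trans Finset.sdiff_subset
  have hdis : ∀ p : V → Prop, ∀ [DecidablePred p],
      Disjoint ((G.neighborFinset v \ A).filter p) A :=
    fun p _ => Finset.sdiff_disjoint.mono_left (Finset.filter_subset _ _)
  have h4 := card_four_neighbors_le hM hA hind (fun v hv => (hk v hv).trans (by norm_num)) hv
    (hsub _) (hdis fun y => #(G.neighborFinset y ∩ A) = 4) (fun y hy => (Finset.mem_filter.1 hy).2)
  have h3 : ∀ y ∈ (G.neighborFinset v \ A).filter (fun y => ¬ #(G.neighborFinset y ∩ A) = 4),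
      #(G.neighborFinset y ∩ A) ≤ 3 := by
    intro y hy
    rw [Finset.mem_filter, Finset.mem_sdiff] at hy
    have := hk y hy.1.2
    omega
  have hkv := hk v hv
  -- The degree is at most `2 + 7 + 28 = 37` in the first case and `4 + 7 + 9 = 20` in the second.
  rcases le_or_gt #(G.neighborFinset v ∩ A) 2 with h | h
  · have := card_le_of_few_coclique_neighbors hM hA hind hv h (hsub _) (hdis _) h3
    omega
  · have := card_le_of_many_coclique_neighbors hM hA hind hv h hkv (hsub _) (hdis _) h3
    omega

/-- The nullity bound for a graph with a coclique of size `29`. -/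
theorem finrank_seidelKer_of_coclique
    (hM : ∀ x : V → ℝ, 0 ≤ 2 * adjQuad G x + (∑ v, x v) ^ 2)
    (hn : 277 ≤ Fintype.card V)
    {A : Finset V} (hA : #A = 29) (hind : ∀ a ∈ A, ∀ b ∈ A, ¬ G.Adj a b)
    (hk : ∀ v ∉ A, #(G.neighborFinset v ∩ A) ≤ 14) :
    3 * (Module.finrank ℝ (seidelKer G) + 1) ≤ Fintype.card V := by
  have hk5 := fun v hv => coclique_degree_le_five hM hA hind hv (hk v hv)
  have hk4 := fun v hv => coclique_degree_le_four hM hn hA hind hk5 (v := v) hv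
  have hd := degree_le_of_coclique hM hA hind hk4
  refine finrank_seidelKer_of_degree_le_four hM hn fun v => ?_
  by_contra! hcon
  rw [← SimpleGraph.card_neighborFinset_eq_degree] at hcon
  obtain ⟨Y, hY, hYc⟩ := Finset.exists_subset_card_eq hcon
  have h6 : #(insert v Y) = 6 := by
    rw [Finset.card_insert_of_notMem (fun h => by simpa using hY h), hYc]
  -- The closed neighbourhood has at most `6 * 38 = 228` vertices, leaving the 46 that are needed.
  have hZ := card_closedNbhd_le (G := G) (insert v Y) (d := 37) fun u _ => hd u
  refine not_star_of_card hM hY hYc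
    (Z := insert v Y ∪ (insert v Y).biUnion fun v => G.neighborFinset v)
    (Finset.mem_union_left _ (Finset.mem_insert_self _ _)) ?_ ?_ (by omega)
  · exact fun w hw => Finset.mem_union_right _
      (Finset.mem_biUnion.2 ⟨v, Finset.mem_insert_self _ _, hw⟩)
  · exact fun y hy w hw => Finset.mem_union_right _
      (Finset.mem_biUnion.2 ⟨y, Finset.mem_insert_of_mem hy, hw⟩)

end DegreeBound

/-! ### From the switching class to a graph with a coclique. -/

section Switching

lemma posSemidef_of_isLeast_eigenvalue {n : Type*} [Fintype n] [DecidableEq n]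
    {S : Matrix n n ℝ} (hS : S.IsSymm) {c : ℝ}
    (hmin : IsLeast {μ : ℝ | Module.End.HasEigenvalue (Matrix.toLin' S) μ} (-c)) :
    (S + c • (1 : Matrix n n ℝ)).PosSemidef := by
  have hH : (S + c • (1 : Matrix n n ℝ)).IsHermitian := by
    rw [Matrix.IsHermitian, Matrix.conjTranspose_eq_transpose_of_trivial, Matrix.transpose_add,
      hS.eq, Matrix.transpose_smul, Matrix.transpose_one]
  rw [hH.posSemidef_iff_eigenvalues_nonneg]
  intro i
  have h1 := hH.mulVec_eigenvectorBasis i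
  have h2 : Module.End.HasEigenvalue (Matrix.toLin' S) (hH.eigenvalues i - c) := by
    refine Module.End.hasEigenvalue_of_hasEigenvector (x := ⇑(hH.eigenvectorBasis i)) ⟨?_, ?_⟩
    · rw [Module.End.mem_eigenspace_iff, Matrix.toLin'_apply, sub_smul, ← h1, Matrix.add_mulVec,
        Matrix.smul_mulVec, Matrix.one_mulVec, add_sub_cancel_right]
    · intro h0
      exact hH.eigenvectorBasis.orthonormal.ne_zero i (by ext j; exact congrFun h0 j)
  have := hmin.2 h2
  rw [Pi.zero_apply]
  linarith

/-- A large independent set of the switching graph is a signed set of indices. -/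
lemma exists_signing_of_le_switchingIndepNum {V : Type*} [Fintype V] [DecidableEq V]
    {S : Matrix V V ℝ} (hS : IsSeidel S) {m : ℕ} (hm : 3 ≤ m) (hα : m ≤ switchingIndepNum S) :
    ∃ (A : Finset V) (σ : V → ℝ), #A = m ∧ (∀ v, σ v = 1 ∨ σ v = -1) ∧
      ∀ a ∈ A, ∀ b ∈ A, a ≠ b → σ a * σ b * S a b ≠ -1 := by
  obtain ⟨s, hs⟩ := (switchingGraph S).exists_isNIndepSet_indepNum
  obtain ⟨T, hTs, hTc⟩ := Finset.exists_subset_card_eq (hα.trans_eq hs.card_eq.symm)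
  have hT : ∀ p ∈ T, ∀ q ∈ T, p ≠ q →
      Matrix.fromBlocks S (1 - S) (1 - S) S p q ≠ -1 := by
    intro p hp q hq hpq h
    refine hs.isIndepSet (hTs hp) (hTs hq) hpq ?_
    rw [switchingGraph, seidelGraph, SimpleGraph.fromRel_adj]
    exact ⟨hpq, Or.inl h⟩
  have hpm : ∀ a b, a ≠ b → (Sum.inl a : V ⊕ V) ∈ T → (Sum.inr b : V ⊕ V) ∈ T → S a b = -1 := by
    intro a b hab ha hb
    have h1 := hT _ ha _ hb (by simp)
    rw [Matrix.fromBlocks_apply₁₂, Matrix.sub_apply, Matrix.one_apply_ne hab] at h1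
    rcases hS.off_diag a b hab with h | h
    · exact absurd (by rw [h]; norm_num) h1
    · exact h
  -- The two copies of an index are nonadjacent, but every other vertex is adjacent to exactly one
  -- of them; a third element, available since `m ≥ 3`, excludes having both.
  have hnot : ∀ a, (Sum.inl a : V ⊕ V) ∈ T → (Sum.inr a : V ⊕ V) ∉ T := by
    intro a h1 h2
    have hc : #({Sum.inl a, Sum.inr a} : Finset (V ⊕ V)) < #T :=
      Finset.card_le_two.trans_lt (by omega)
    obtain ⟨p, hp, hpn⟩ := Finset.exists_mem_notMem_of_card_lt_card hc
    rcases p with b | b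
    · have hab : b ≠ a := fun h => hpn (by simp [h])
      exact hT _ hp _ h1 (by simpa using hab) (hpm b a hab hp h2)
    · have hab : a ≠ b := fun h => hpn (by simp [h])
      have := hpm a b hab h1 hp
      exact hT _ h2 _ hp (by simpa using hab) (by rw [Matrix.fromBlocks_apply₂₂, this])
  have hinj : Set.InjOn (Sum.elim id id : V ⊕ V → V) T := by
    rintro (a | a) ha (b | b) hb h <;> simp only [Sum.elim_inl, Sum.elim_inr, id_eq] at h <;>
      subst h
    · rfl
    · exact absurd hb (hnot _ ha)
    · exact absurd ha (hnot _ hb)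
    · rfl
  refine ⟨T.image (Sum.elim id id), fun v => if Sum.inl v ∈ T then 1 else -1, ?_, ?_, ?_⟩
  · rw [Finset.card_image_of_injOn hinj, hTc]
  · intro v
    by_cases hv : (Sum.inl v : V ⊕ V) ∈ T <;> simp [hv]
  · intro a ha b hb hab
    obtain ⟨p, hp, rfl⟩ := Finset.mem_image.1 ha
    obtain ⟨q, hq, rfl⟩ := Finset.mem_image.1 hb
    have hpq : p ≠ q := fun h => hab (by rw [h])
    have h := hT p hp q hq hpq
    rcases p with a | a <;> rcases q with b | b <;>
      simp only [Sum.elim_inl, Sum.elim_inr, id_eq] at hab ⊢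
    · simpa [hp, hq] using h
    · have hb' : (Sum.inl b : V ⊕ V) ∉ T := fun hb' => hnot _ hb' hq
      simpa [hp, hb', Matrix.one_apply_ne hab] using h
    · have ha' : (Sum.inl a : V ⊕ V) ∉ T := fun ha' => hnot _ ha' hp
      simpa [hq, ha', Matrix.one_apply_ne hab] using h
    · have ha' : (Sum.inl a : V ⊕ V) ∉ T := fun ha' => hnot _ ha' hp
      have hb' : (Sum.inl b : V ⊕ V) ∉ T := fun hb' => hnot _ hb' hq
      simpa [ha', hb'] using h

/-- The signs outside `A` can be chosen so that at most half of the entries towards `A` are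
negative. -/
lemma exists_signing_balanced {V : Type*} [DecidableEq V] {S : Matrix V V ℝ}
    (hS : IsSeidel S) {A : Finset V} {σ : V → ℝ} (hσ : ∀ v, σ v = 1 ∨ σ v = -1) :
    ∃ τ : V → ℝ, (∀ v, τ v = 1 ∨ τ v = -1) ∧ (∀ a ∈ A, τ a = σ a) ∧
      ∀ v ∉ A, 2 * #{a ∈ A | τ v * τ a * S v a = -1} ≤ #A := by
  classical
  refine ⟨fun v => if v ∈ A then σ v else
    if 2 * #{a ∈ A | σ a * S v a = -1} ≤ #A then 1 else -1, ?_, ?_, ?_⟩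
  · intro v
    dsimp only
    split_ifs
    · exact hσ v
    · exact Or.inl rfl
    · exact Or.inr rfl
  · intro a ha
    simp [ha]
  · intro v hv
    by_cases h : 2 * #{a ∈ A | σ a * S v a = -1} ≤ #A
    · refine le_trans (le_of_eq ?_) h
      congr 2
      refine Finset.filter_congr fun a ha => ?_
      simp [hv, ha, h]
    -- Switching at `v` exchanges its neighbours and non-neighbours in `A`.
    · have hsp := Finset.card_filter_add_card_filter_not (s := A) (fun a => σ a * S v a = -1)
      have h2 : #{a ∈ A | ((if v ∈ A then σ v else
          if 2 * #{a ∈ A | σ a * S v a = -1} ≤ #A then 1 else -1) *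
          (if a ∈ A then σ a else
          if 2 * #{b ∈ A | σ b * S a b = -1} ≤ #A then 1 else -1) * S v a = -1)} =
          #{a ∈ A | ¬ σ a * S v a = -1} := by
        congr 1
        refine Finset.filter_congr fun a ha => ?_
        have hva : v ≠ a := fun h => hv (h ▸ ha)
        simp only [hv, ha, h, if_true, if_false]
        rcases hσ a with h1 | h1 <;> rcases hS.off_diag v a hva with h2 | h2 <;>
          rw [h1, h2] <;> norm_num
      dsimp only at *
      omega

end Switching

theorem mainTheorem6 (n : ℕ) (hn : 277 ≤ n) (S : Matrix (Fin n) (Fin n) ℝ) (hS : IsSeidel S)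
    (hmin : IsLeast {μ : ℝ | Module.End.HasEigenvalue (Matrix.toLin' S) μ} (-5))
    (hω : switchingCliqueNum S = 4) (hα : 29 ≤ switchingIndepNum S) :
    2 * (n : ℝ) / 3 + 1 ≤ ((S + (5 : ℝ) • (1 : Matrix (Fin n) (Fin n) ℝ)).rank : ℝ) := by
  classical
  have hpsd := posSemidef_of_isLeast_eigenvalue hS.isSymm hmin
  obtain ⟨A, σ, hA, hσ, hind⟩ := exists_signing_of_le_switchingIndepNum hS (by norm_num) hα
  obtain ⟨τ, hτ, hτA, hbal⟩ := exists_signing_balanced hS (A := A) hσ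
  set M := S + (5 : ℝ) • (1 : Matrix (Fin n) (Fin n) ℝ) with hMdef
  let G : SimpleGraph (Fin n) :=
    { Adj := fun i j => i ≠ j ∧ τ i * τ j * S i j = -1
      symm := ⟨fun i j h => ⟨h.1.symm, by rw [hS.isSymm.apply, mul_comm (τ j)]; exact h.2⟩⟩
      loopless := ⟨fun i h => h.1 rfl⟩ }
  have hgram : seidelGram G = Matrix.diagonal τ * M * Matrix.diagonal τ := by
    ext i j
    rw [Matrix.mul_diagonal, Matrix.diagonal_mul]
    by_cases hij : i = j
    · subst hij
      have : τ i * τ i = 1 := by rcases hτ i with h | h <;> rw [h] <;> norm_num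
      simp [seidelGram, M, hS.diag_eq_zero]
      linarith
    · have hadj : G.Adj i j ↔ τ i * τ j * S i j = -1 := ⟨fun h => h.2, fun h => ⟨hij, h⟩⟩
      simp only [seidelGram, M, Matrix.add_apply, Matrix.sub_apply, Matrix.smul_apply,
        Matrix.one_apply_ne hij, SimpleGraph.adjMatrix_apply, hadj, Matrix.of_apply, smul_eq_mul]
      rcases hτ i with h1 | h1 <;> rcases hτ j with h2 | h2 <;>
        rcases hS.off_diag i j hij with h3 | h3 <;> rw [h1, h2, h3] <;> norm_num
  have hdet : IsUnit (Matrix.diagonal τ).det := by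
    rw [Matrix.det_diagonal, isUnit_iff_ne_zero]
    refine Finset.prod_ne_zero_iff.2 fun i _ => ?_
    rcases hτ i with h | h <;> rw [h] <;> norm_num
  have hrank : (seidelGram G).rank = M.rank := by
    rw [hgram, Matrix.rank_mul_eq_left_of_isUnit_det _ _ hdet,
      Matrix.rank_mul_eq_right_of_isUnit_det _ _ hdet]
  have hM : ∀ x : Fin n → ℝ, 0 ≤ 2 * adjQuad G x + (∑ v, x v) ^ 2 := by
    intro x
    have h := (hpsd.mul_mul_conjTranspose_same (Matrix.diagonal τ)).dotProduct_mulVec_nonneg x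
    rw [Matrix.diagonal_conjTranspose, star_trivial, star_trivial, ← hgram, seidelGram_quad] at h
    exact h
  have hker := finrank_seidelKer_of_coclique hM (by simpa using hn) hA
    (fun a ha b hb h => hind a ha b hb h.1 (by rw [← hτA a ha, ← hτA b hb]; exact h.2))
    -- Half of the odd number 29 rounds down to 14.
    (fun v hv => by
      have h1 := hbal v hv
      have h2 : G.neighborFinset v ∩ A ⊆ {a ∈ A | τ v * τ a * S v a = -1} := by
        intro a ha
        rw [Finset.mem_inter, SimpleGraph.mem_neighborFinset] at ha
        exact Finset.mem_filter.2 ⟨ha.2, ha.1.2⟩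
      have h3 := Finset.card_le_card h2
      omega)
  have hrn := (seidelGram G).mulVecLin.finrank_range_add_finrank_ker
  have h1 : Module.finrank ℝ (LinearMap.range (seidelGram G).mulVecLin) = M.rank := hrank
  rw [h1, Module.finrank_fintype_fun_eq_card, Fintype.card_fin] at hrn
  rw [Fintype.card_fin, seidelKer] at hker
  have h2 : 2 * n + 3 ≤ 3 * M.rank := by omega
  have h3 : 2 * (n : ℝ) + 3 ≤ 3 * M.rank := by exact_mod_cast h2
  linarith
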